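/- **Theorem 1.** Let $Q\subset\mathbb R^2$ be a convex polygon with $r\ge 3$ sides (all interior angles smaller than $\pi$), whose sides are labelled by $r$ distinct letters. A ball moves in $Q$ with unit speed along straight lines and is reflected at the sides by the mirror law. For $n\ge 1$ let $p(n)$ be the number of words of length $n$ that arise as the sequence of sides hit at $n$ successive boundary points of a billiard orbit segment none of whose boundary points is a vertex, and let $p(0)=0$. A generalized diagonal of combinatorial length $n\ge 1$ is an oriented billiard orbit segment with $n$ links that begins and ends in a vertex (possibly the same one), contains no vertex in its interior, and whose links run through the interior of $Q$ (so the sides of $Q$ do not count); the vertices of $Q$ are counted as the generalized diagonals of combinatorial length $0$. For $j\ge 0$ let $N_c(j)$ be the number of generalized diagonals of combinatorial length at most $j$; in particular $N_c(0)=r$, and the $r$ vertices are included in every $N_c(j)$. Then every $N_c(j)$ is finite, and $$p(n)=\sum_{j=0}^{n-1}N_c(j)\qquad\text{for all } n\ge 0.$$ -/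

import Mathlib

noncomputable section

namespace PolygonalBilliard

/-- The Euclidean plane. -/
abbrev Plane : Type := EuclideanSpace ℝ (Fin 2)

/-- The determinant of two vectors of the plane. -/
def cross (u v : Plane) : ℝ := u 0 * v 1 - u 1 * v 0

/-- The polygon with the cyclic list of vertices `Q 0, …, Q (r - 1)` is a (nondegenerate) convex
polygon, listed counterclockwise: for each side, all the vertices that are not endpoints of that
side lie strictly to the left of it. In particular all interior angles are smaller than `π`.
The successor of the index `i` is `finRotate r i`, that is, `i + 1` modulo `r`. -/
def IsConvexPolygon {r : ℕ} (Q : Polygon Plane r) : Prop :=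
  3 ≤ r ∧ ∀ i k : Fin r, k ≠ i → k ≠ finRotate r i →
    0 < cross (Q (finRotate r i) - Q i) (Q k - Q i)

variable {r : ℕ} (Q : Polygon Plane r)

/-- The interior of the table: the interior of the convex hull of the vertices. -/
def inside : Set Plane := interior (convexHull ℝ (Set.range Q.vertices))

/-- The side with label `i`, without its endpoints. -/
def openSide (i : Fin r) : Set Plane := openSegment ℝ (Q i) (Q (finRotate r i))

/-- The mirror law at the side `i`: the linear reflection in the direction of that side. -/
def mirror (i : Fin r) (v : Plane) : Plane :=
  (Submodule.span ℝ {Q (finRotate r i) - Q i}).reflection v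

/-- The phase space: pairs `(s, v)` of a boundary point `s` and an inner pointing unit vector
`v` at `s`. -/
def phaseSpace : Set (Plane × Plane) :=
  {x | x.1 ∈ Q.boundary ℝ ∧ ‖x.2‖ = 1 ∧
    ∃ ε : ℝ, 0 < ε ∧ ∀ t ∈ Set.Ioo 0 ε, x.1 + t • x.2 ∈ inside Q}

/-- The ball that leaves the footpoint of `x` with the velocity of `x` runs through the interior
of the table until it reaches the boundary at the point `s`. -/
def Reaches (x : Plane × Plane) (s : Plane) : Prop :=
  s ∈ Q.boundary ℝ ∧ (∃ t : ℝ, 0 < t ∧ s = x.1 + t • x.2) ∧ openSegment ℝ x.1 s ⊆ inside Q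

/-- The graph of the billiard ball map `T`: `y = T x`, where the ball that starts at `x` reaches
the boundary at a point that is not a vertex and is reflected there by the mirror law. -/
def BilliardMap (x y : Plane × Plane) : Prop :=
  Reaches Q x y.1 ∧ ∃ i : Fin r, y.1 ∈ openSide Q i ∧ y.2 = mirror Q i x.2

/-- The words of length `n` that arise from coding billiard orbits by the sides they hit: the codes
of the `n` successive phase points `x, T x, …, T^(n-1) x`, none of whose footpoints is a vertex. -/
def language (n : ℕ) : Set (Fin n → Fin r) :=
  {w | ∃ x : Fin n → Plane × Plane,
    (∀ k, x k ∈ phaseSpace Q ∧ (x k).1 ∈ openSide Q (w k)) ∧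
    ∀ k l : Fin n, (l : ℕ) = k + 1 → BilliardMap Q (x k) (x l)}

/-- The complexity function of the language, with the convention `p(0) = 0`. -/
def complexity (n : ℕ) : ℕ := if n = 0 then 0 else (language Q n).ncard

/-- The generalized diagonals of combinatorial length `n`: the oriented billiard orbit segments
with `n` links that begin and end in a vertex, given by their successive boundary points
`q 0, …, q n`. The ball leaves `q k` with velocity `v k` and reaches `q (k + 1)`; the intermediate
boundary points are not vertices, and the mirror law holds there. The links run through the
interior of the table, so the sides of the polygon do not count. For `n = 0` these are the
vertices. -/
def IsGeneralizedDiagonal (n : ℕ) (q : Fin (n + 1) → Plane) : Prop :=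
  q 0 ∈ Set.range Q.vertices ∧ q (Fin.last n) ∈ Set.range Q.vertices ∧
  ∃ v : Fin n → Plane,
    (∀ k : Fin n, (q k.castSucc, v k) ∈ phaseSpace Q ∧ Reaches Q (q k.castSucc, v k) (q k.succ)) ∧
    ∀ k l : Fin n, (l : ℕ) = k + 1 →
      BilliardMap Q (q k.castSucc, v k) (q l.castSucc, v l)

/-- The generalized diagonals of combinatorial length at most `j` (vertices included, as those of
length `0`). -/
def generalizedDiagonals (j : ℕ) : Set (Σ n : ℕ, Fin (n + 1) → Plane) :=
  {g | g.1 ≤ j ∧ IsGeneralizedDiagonal Q g.1 g.2}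

/-- The number `N_c(j)` of generalized diagonals of combinatorial length at most `j`. -/
def diagonalCount (j : ℕ) : ℕ := (generalizedDiagonals Q j).ncard

end PolygonalBilliard

end

/-!
# The complexity of the billiard in a convex polygon

The proof counts extensions of words. Oriented lines are encoded by pairs `(v, c)` of a direction and
a moment, so that the position of a line relative to a point is a linear function `side p` of the
line and the reflection in a side of the table is a linear map. The lines whose billiard orbit hits
prescribed sides one after the other then form an open convex set.

Relative to a line that crosses a convex polygon, the sign of `side` changes only once along the
consecutive vertices from the place of entry on (`IsConvexPolygon.side_neg_of_side_nonpos`). Hence the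
vertices cut an open convex family of lines with a common place of entry into consecutive strips,
and the family leaves the table through one side more than it leaves through vertices
(`card_sign_changes`, `IsConvexPolygon.card_exits`). This count is applied twice.

* To the lines of a word `w` of length `n ≥ 1`, followed backwards: the number of letters `a` for
  which `a w` is a word is one more than the number of vertices from which `w` is seen
  (`IsConvexPolygon.card_left_extensions`). So `p (n + 1) - p n` is the number of pairs of a vertex
  and a word of length `n` that is seen from it, that is, of nonempty fans.
* To the fan of the lines that start in a vertex `a` and then follow a word `w`: the number of
  letters `j` for which `w j` is seen from `a` is one more than the number of vertices at which a
  generalized diagonal from `a` with the word `w` can end (`IsConvexPolygon.card_fan_extensions`).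
  So, by passing from `n` to `n + 1`, the number of fans grows by the number of generalized diagonals
  of length `n + 1`. As there are `r` fans of length `0`, one for each vertex, there are `N_c(n)` fans
  of length `n` (`IsConvexPolygon.diagonalCount_eq_fanCount`).

The second application needs that no condition "the orbit hits the vertex `b`" holds identically on a
fan, and the count of diagonals needs that a generalized diagonal is determined by its end points and
its word. Both hold because in the unfolded table a generalized diagonal is a straight segment of
positive length (`IsConvexPolygon.unfold_vertex_eq`).
-/

noncomputable section

namespace PolygonalBilliard

open Set Filter Topology

variable {r : ℕ} {Q : Polygon Plane r}

/-! ### Determinants and cyclic indices -/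

lemma cross_add_left (u v w : Plane) : cross (u + v) w = cross u w + cross v w := by
  simp [cross]; ring

lemma cross_add_right (u v w : Plane) : cross u (v + w) = cross u v + cross u w := by
  simp [cross]; ring

lemma cross_sub_left (u v w : Plane) : cross (u - v) w = cross u w - cross v w := by
  simp [cross]; ring

lemma cross_sub_right (u v w : Plane) : cross u (v - w) = cross u v - cross u w := by
  simp [cross]; ring

lemma cross_smul_left (a : ℝ) (u v : Plane) : cross (a • u) v = a * cross u v := by
  simp [cross]; ring

lemma cross_smul_right (a : ℝ) (u v : Plane) : cross u (a • v) = a * cross u v := by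
  simp [cross]; ring

@[simp] lemma cross_self (u : Plane) : cross u u = 0 := by
  simp [cross]; ring

@[simp] lemma cross_zero_left (u : Plane) : cross 0 u = 0 := by simp [cross]

@[simp] lemma cross_zero_right (u : Plane) : cross u 0 = 0 := by simp [cross]

lemma cross_swap (u v : Plane) : cross u v = -cross v u := by
  simp [cross]; ring

@[fun_prop]
lemma continuous_cross {X : Type*} [TopologicalSpace X] {f g : X → Plane} (hf : Continuous f)
    (hg : Continuous g) : Continuous fun x => cross (f x) (g x) := by
  unfold cross; fun_prop

lemma exists_eq_smul_of_cross_eq_zero {u v : Plane} (hv : v ≠ 0) (h : cross u v = 0) :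
    ∃ t : ℝ, u = t • v := by
  have h' : u 0 * v 1 = u 1 * v 0 := by simpa [cross, sub_eq_zero] using h
  by_cases h0 : v 0 = 0
  · have h1 : v 1 ≠ 0 := by
      intro h1; apply hv; ext i; fin_cases i <;> simp [h0, h1]
    refine ⟨u 1 / v 1, ?_⟩
    have : u 0 = 0 := by simpa [h0, h1] using h'
    ext i; fin_cases i
    · simp [h0, this]
    · simp [h1]
  · refine ⟨u 0 / v 0, ?_⟩
    ext i; fin_cases i
    · simp [h0]
    · simp only [Fin.mk_one, PiLp.smul_apply, smul_eq_mul]; field_simp; linarith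

lemma eq_zero_of_forall_cross_eq_zero {u : Plane} (h : ∀ v, cross u v = 0) : u = 0 := by
  have h0 := h !₂[1, 0]
  have h1 := h !₂[0, 1]
  simp [cross] at h0 h1
  ext i; fin_cases i <;> simp [h0, h1]

lemma val_finRotate_iterate (i : Fin r) (k : ℕ) :
    (((finRotate r)^[k] i : Fin r) : ℕ) = (i + k) % r := by
  obtain ⟨m, rfl⟩ : ∃ m, r = m + 1 := ⟨r - 1, by have := i.2; omega⟩
  induction k with
  | zero => simp [Nat.mod_eq_of_lt i.2]
  | succ k ih =>
    rw [Function.iterate_succ_apply', finRotate_apply, Fin.val_add, ih, Fin.val_one', Nat.add_mod_mod,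
      Nat.mod_add_mod, add_assoc]

lemma finRotate_iterate_self (i : Fin r) : (finRotate r)^[r] i = i := by
  ext; rw [val_finRotate_iterate]; simp [Nat.mod_eq_of_lt i.2]

lemma finRotate_iterate_ne (i : Fin r) {k l : ℕ} (hkl : k < l) (hl : l < k + r) :
    (finRotate r)^[k] i ≠ (finRotate r)^[l] i := by
  intro h
  have h' := congrArg Fin.val h
  rw [val_finRotate_iterate, val_finRotate_iterate] at h'
  have h2 : (i + k : ℕ) ≡ i + l [MOD r] := h'
  have h3 : k ≡ l [MOD r] := Nat.ModEq.add_left_cancel' _ h2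
  have h4 := (Nat.modEq_iff_dvd' hkl.le).1 h3
  have := Nat.le_of_dvd (by omega) h4
  omega

lemma exists_finRotate_iterate (i j : Fin r) : ∃ k < r, (finRotate r)^[k] i = j := by
  refine ⟨(j + (r - i)) % r, Nat.mod_lt _ (by have := i.2; omega), ?_⟩
  ext; rw [val_finRotate_iterate, Nat.add_mod_mod]
  have : (i + (j + (r - i)) : ℕ) = j + r := by have := i.2; omega
  rw [this]; simp [Nat.mod_eq_of_lt j.2]

/-! ### Geometry of a convex polygon -/

/-- The direction vector of the side `i`. -/
def edge (Q : Polygon Plane r) (i : Fin r) : Plane := Q (finRotate r i) - Q i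

/-- A multiple of the signed distance of `p` from the line that carries the side `i`; it is positive
on the side of that line on which the polygon lies. -/
def height (Q : Polygon Plane r) (i : Fin r) (p : Plane) : ℝ := cross (edge Q i) (p - Q i)

lemma height_add_smul (i : Fin r) (p v : Plane) (t : ℝ) :
    height Q i (p + t • v) = height Q i p + t * cross (edge Q i) v := by
  rw [height, add_sub_right_comm, cross_add_right, cross_smul_right, height]

lemma continuous_height (i : Fin r) : Continuous (height Q i) := by
  unfold height; fun_prop

lemma height_convexCombo (i : Fin r) (p q : Plane) {a b : ℝ} (hab : a + b = 1) :
    height Q i (a • p + b • q) = a * height Q i p + b * height Q i q := by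
  have : a • p + b • q - Q i = a • (p - Q i) + b • (q - Q i) := by
    have : Q i = (a + b) • Q i := by rw [hab, one_smul]
    nth_rw 1 [this]; module
  rw [height, this, cross_add_right, cross_smul_right, cross_smul_right]; rfl

@[simp] lemma height_start (i : Fin r) : height Q i (Q i) = 0 := by simp [height]

@[simp] lemma height_end (i : Fin r) : height Q i (Q (finRotate r i)) = 0 := by
  simp [height, edge]

lemma IsConvexPolygon.height_pos (hQ : IsConvexPolygon Q) {i k : Fin r} (h₁ : k ≠ i)
    (h₂ : k ≠ finRotate r i) : 0 < height Q i (Q k) := hQ.2 i k h₁ h₂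

lemma IsConvexPolygon.height_nonneg (hQ : IsConvexPolygon Q) (i k : Fin r) :
    0 ≤ height Q i (Q k) := by
  by_cases h₁ : k = i
  · simp [h₁]
  by_cases h₂ : k = finRotate r i
  · rw [h₂, height_end]
  exact (hQ.height_pos h₁ h₂).le

lemma IsConvexPolygon.finRotate_ne (hQ : IsConvexPolygon Q) (i : Fin r) : finRotate r i ≠ i :=
  (finRotate_iterate_ne i (k := 0) (l := 1) (by omega) (by have := hQ.1; omega)).symm

lemma IsConvexPolygon.finRotate_finRotate_ne (hQ : IsConvexPolygon Q) (i : Fin r) :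
    finRotate r (finRotate r i) ≠ i :=
  (finRotate_iterate_ne i (k := 0) (l := 2) (by omega) (by have := hQ.1; omega)).symm

/-- Every triple of vertices in cyclic order is positively oriented. The hypothesis is the case of
two consecutive vertices; seen from a fixed vertex, the others lie in a half plane, and there
"to the left of" is transitive. -/
lemma IsConvexPolygon.triple_pos (hQ : IsConvexPolygon Q) (i : Fin r) {a b c : ℕ} (hab : a < b)
    (hbc : b < c) (hc : c < a + r) :
    0 < cross (Q ((finRotate r)^[b] i) - Q ((finRotate r)^[a] i))
      (Q ((finRotate r)^[c] i) - Q ((finRotate r)^[a] i)) := by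
  set Z : ℕ → Plane := fun k => Q ((finRotate r)^[k] i) with hZ
  have hcons : ∀ k l, k + 1 < l → l < k + r → 0 < cross (Z (k + 1) - Z k) (Z l - Z k) := by
    intro k l h1 h2
    have := hQ.2 ((finRotate r)^[k] i) ((finRotate r)^[l] i)
      (finRotate_iterate_ne i (by omega) h2).symm
      (by rw [← Function.iterate_succ_apply' (finRotate r)]
          exact (finRotate_iterate_ne i h1 (by omega)).symm)
    rw [← Function.iterate_succ_apply' (finRotate r)] at this
    exact this
  have hback : ∀ k, a < k → k + 1 < a + r → 0 < cross (Z k - Z a) (Z (k + 1) - Z a) := by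
    intro k h1 h2
    have h3 := hcons k (a + r) (by omega) (by omega)
    have h4 : Z (a + r) = Z a := by
      simp only [hZ]; rw [Function.iterate_add_apply, finRotate_iterate_self]
    rw [h4] at h3
    have : cross (Z (k + 1) - Z k) (Z a - Z k) = cross (Z k - Z a) (Z (k + 1) - Z a) := by
      simp [cross]; ring
    rwa [this] at h3
  change 0 < cross (Z b - Z a) (Z c - Z a)
  obtain rfl | hb := (Nat.succ_le_of_lt hab).eq_or_lt
  · exact hcons a c hbc hc
  induction c, (Nat.succ_le_of_lt hbc) using Nat.le_induction with
  | base => exact hback b hab hc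
  | succ c hbc' ih =>
    have hbc' : b < c := hbc'
    have h1 := ih hbc' (by omega)
    have h2 := hback c (by omega) hc
    have hB := hcons a b hb (by omega)
    have hC := hcons a c (by omega) (by omega)
    have hD := hcons a (c + 1) (by omega) (by omega)
    have key : cross (Z (a + 1) - Z a) (Z c - Z a) * cross (Z b - Z a) (Z (c + 1) - Z a) =
        cross (Z (a + 1) - Z a) (Z b - Z a) * cross (Z c - Z a) (Z (c + 1) - Z a) +
        cross (Z (a + 1) - Z a) (Z (c + 1) - Z a) * cross (Z b - Z a) (Z c - Z a) := by
      simp only [cross]; ring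
    have : 0 < cross (Z (a + 1) - Z a) (Z c - Z a) * cross (Z b - Z a) (Z (c + 1) - Z a) := by
      rw [key]; positivity
    exact (mul_pos_iff_of_pos_left hC).1 this

lemma IsConvexPolygon.injective (hQ : IsConvexPolygon Q) : Function.Injective Q.vertices := by
  intro a b hab
  by_contra hne
  change Q a = Q b at hab
  have ha := hQ.finRotate_ne a
  have h2 := hQ.finRotate_finRotate_ne a
  by_cases hb : b = finRotate r a
  · have := hQ.height_pos (i := a) (k := finRotate r (finRotate r a)) h2 (hQ.finRotate_ne _)
    rw [height, edge, ← hb, ← hab] at this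
    simp at this
  · have := hQ.height_pos (i := a) (k := b) (Ne.symm hne) hb
    rw [← hab] at this
    simp at this

/-- A point to the left of all sides lies in one of the triangles into which the diagonals from the
vertex `i` cut the polygon. -/
lemma IsConvexPolygon.mem_convexHull (hQ : IsConvexPolygon Q) {p : Plane}
    (hp : ∀ i, 0 < height Q i p) : p ∈ convexHull ℝ (range Q.vertices) := by
  have hr := hQ.1
  set i : Fin r := ⟨0, by omega⟩
  set Z : ℕ → Plane := fun k => Q ((finRotate r)^[k] i) with hZ
  have hmem : ∀ k, Z k ∈ convexHull ℝ (range Q.vertices) :=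
    fun k => subset_convexHull ℝ _ ⟨_, rfl⟩
  have hside : ∀ k, 0 < cross (Z (k + 1) - Z k) (p - Z k) := by
    intro k
    have := hp ((finRotate r)^[k] i)
    rwa [height, edge, ← Function.iterate_succ_apply' (finRotate r)] at this
  have hlast : cross (Z (r - 1) - Z 0) (p - Z 0) < 0 := by
    have h := hside (r - 1)
    have h4 : Z (r - 1 + 1) = Z 0 := by
      simp only [hZ]; rw [show r - 1 + 1 = r by omega, finRotate_iterate_self]; rfl
    rw [h4] at h
    have : cross (Z 0 - Z (r - 1)) (p - Z (r - 1)) = -cross (Z (r - 1) - Z 0) (p - Z 0) := by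
      simp [cross]; ring
    linarith
  -- the last vertex to the right of which (seen from `Z 0`) the point `p` does not lie
  obtain ⟨k, hk0, hkr, hk1, hk2⟩ : ∃ k, 1 ≤ k ∧ k + 1 ≤ r - 1 ∧ 0 ≤ cross (Z k - Z 0) (p - Z 0) ∧
      cross (Z (k + 1) - Z 0) (p - Z 0) < 0 := by
    by_contra! hcon
    have : ∀ k, 1 ≤ k → k ≤ r - 1 → 0 ≤ cross (Z k - Z 0) (p - Z 0) := by
      intro k hk
      induction k, hk using Nat.le_induction with
      | base => intro _; exact (hside 0).le
      | succ k hk ih => intro h; exact hcon k hk h (ih (by omega))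
    exact absurd hlast (not_lt.2 (this (r - 1) (by omega) le_rfl))
  have hD : 0 < cross (Z k - Z 0) (Z (k + 1) - Z 0) :=
    hQ.triple_pos i (a := 0) (by omega) (by omega) (by omega)
  set D := cross (Z k - Z 0) (Z (k + 1) - Z 0) with hDdef
  set α := cross (Z (k + 1) - Z k) (p - Z k)
  set β := -cross (Z (k + 1) - Z 0) (p - Z 0)
  set γ := cross (Z k - Z 0) (p - Z 0)
  have hsum : α + β + γ = D := by simp only [α, β, γ, D, cross]; simp; ring
  have hcomb : D • p = α • Z 0 + β • Z k + γ • Z (k + 1) := by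
    ext j
    fin_cases j <;> simp [α, β, γ, D, cross] <;> ring
  have hp' : p = (α / D) • Z 0 + (β / D) • Z k + (γ / D) • Z (k + 1) := by
    have : p = D⁻¹ • (D • p) := by rw [smul_smul, inv_mul_cancel₀ hD.ne', one_smul]
    rw [this, hcomb]; simp only [smul_add, smul_smul, div_eq_inv_mul]
  have hα : 0 < α := hside k
  have hβ : 0 < β := by simp only [β]; linarith
  have hconv := convex_convexHull ℝ (range Q.vertices)
  rw [hp']
  have := hconv.sum_mem (t := Finset.univ) (w := ![α / D, β / D, γ / D])
    (z := ![Z 0, Z k, Z (k + 1)])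
    (by intro j _; fin_cases j <;> simp <;> positivity)
    (by simp [Fin.sum_univ_three]; field_simp; exact hsum)
    (by intro j _; fin_cases j <;> simp [hmem])
  simpa [Fin.sum_univ_three] using this

lemma IsConvexPolygon.height_nonneg_of_mem_convexHull (hQ : IsConvexPolygon Q) {p : Plane}
    (hp : p ∈ convexHull ℝ (range Q.vertices)) (i : Fin r) : 0 ≤ height Q i p := by
  have hconv : Convex ℝ {p | 0 ≤ height Q i p} := by
    intro p hp q hq a b ha hb hab
    simp only [mem_ofPred_eq] at *
    rw [height_convexCombo i p q hab]; positivity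
  refine convexHull_min ?_ hconv hp
  rintro _ ⟨k, rfl⟩
  exact hQ.height_nonneg i k

lemma IsConvexPolygon.edge_ne_zero (hQ : IsConvexPolygon Q) (i : Fin r) : edge Q i ≠ 0 := by
  intro h
  exact hQ.finRotate_ne i (hQ.injective (sub_eq_zero.1 h))

/-- The interior of the table is the intersection of the open half planes to the left of the
sides. -/
lemma IsConvexPolygon.mem_inside_iff (hQ : IsConvexPolygon Q) {p : Plane} :
    p ∈ inside Q ↔ ∀ i, 0 < height Q i p := by
  constructor
  · intro hp i
    have hcont : Continuous fun t : ℝ => p + t • (!₂[edge Q i 1, -edge Q i 0] : Plane) := by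
      fun_prop
    have hev : ∀ᶠ t : ℝ in 𝓝 0, p + t • (!₂[edge Q i 1, -edge Q i 0] : Plane) ∈ inside Q :=
      hcont.continuousAt.eventually_mem (by
        rw [zero_smul, add_zero]; exact isOpen_interior.mem_nhds hp)
    obtain ⟨t, ht, ht0⟩ := ((hev.filter_mono nhdsWithin_le_nhds).and
      (self_mem_nhdsWithin : Ioi (0 : ℝ) ∈ 𝓝[>] 0)).exists
    have h := hQ.height_nonneg_of_mem_convexHull (interior_subset ht) i
    rw [height_add_smul] at h
    have hc : cross (edge Q i) !₂[edge Q i 1, -edge Q i 0] < 0 := by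
      have hne := hQ.edge_ne_zero i
      have : edge Q i 0 ≠ 0 ∨ edge Q i 1 ≠ 0 := by
        by_contra! h
        exact hne (by ext j; fin_cases j <;> simp [h])
      have : cross (edge Q i) !₂[edge Q i 1, -edge Q i 0] = -(edge Q i 0 ^ 2 + edge Q i 1 ^ 2) := by
        simp [cross]; ring
      rw [this]
      rcases ‹_ ∨ _› with h | h
      · nlinarith [sq_nonneg (edge Q i 1), sq_pos_of_ne_zero h]
      · nlinarith [sq_nonneg (edge Q i 0), sq_pos_of_ne_zero h]
    have ht0 : 0 < t := ht0
    nlinarith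
  · intro hp
    have hopen : IsOpen {p | ∀ i, 0 < height Q i p} := by
      simp only [ofPred_forall]
      exact isOpen_iInter_of_finite fun i => isOpen_lt continuous_const (continuous_height i)
    exact interior_maximal (fun q hq => hQ.mem_convexHull hq) hopen hp

lemma height_eq_zero_of_mem_segment {i : Fin r} {p : Plane}
    (hp : p ∈ segment ℝ (Q i) (Q (finRotate r i))) : height Q i p = 0 := by
  obtain ⟨a, b, ha, hb, hab, rfl⟩ := hp
  rw [height_convexCombo i _ _ hab, height_start, height_end]; ring

lemma mem_boundary_iff {p : Plane} :
    p ∈ Q.boundary ℝ ↔ ∃ i, p ∈ segment ℝ (Q i) (Q (finRotate r i)) := by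
  simp [Polygon.boundary, Polygon.edgeSet, affineSegment_eq_segment]

lemma openSide_subset_boundary {i : Fin r} {p : Plane} (hp : p ∈ openSide Q i) :
    p ∈ Q.boundary ℝ := mem_boundary_iff.2 ⟨i, openSegment_subset_segment _ _ _ hp⟩

lemma vertex_mem_boundary (i : Fin r) : Q i ∈ Q.boundary ℝ :=
  mem_boundary_iff.2 ⟨i, left_mem_segment _ _ _⟩

lemma IsConvexPolygon.height_nonneg_of_mem_boundary (hQ : IsConvexPolygon Q) {p : Plane}
    (hp : p ∈ Q.boundary ℝ) (i : Fin r) : 0 ≤ height Q i p := by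
  obtain ⟨j, hj⟩ := mem_boundary_iff.1 hp
  obtain ⟨a, b, ha, hb, hab, rfl⟩ := hj
  rw [height_convexCombo i _ _ hab]
  have h1 := hQ.height_nonneg i j
  have h2 := hQ.height_nonneg i (finRotate r j)
  positivity

lemma IsConvexPolygon.notMem_inside_of_mem_boundary (hQ : IsConvexPolygon Q) {p : Plane}
    (hp : p ∈ Q.boundary ℝ) : p ∉ inside Q := by
  obtain ⟨j, hj⟩ := mem_boundary_iff.1 hp
  intro h
  exact ((hQ.mem_inside_iff.1 h) j).ne' (height_eq_zero_of_mem_segment hj)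

lemma height_openSide {i : Fin r} {p : Plane} (hp : p ∈ openSide Q i) : height Q i p = 0 :=
  height_eq_zero_of_mem_segment (openSegment_subset_segment _ _ _ hp)

lemma IsConvexPolygon.height_pos_of_mem_openSide (hQ : IsConvexPolygon Q) {i j : Fin r}
    (hij : j ≠ i) {p : Plane} (hp : p ∈ openSide Q i) : 0 < height Q j p := by
  obtain ⟨a, b, ha, hb, hab, rfl⟩ := hp
  rw [height_convexCombo j _ _ hab]
  have h1 := hQ.height_nonneg j i
  have h2 := hQ.height_nonneg j (finRotate r i)
  by_cases h : i = finRotate r j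
  · have : 0 < height Q j (Q (finRotate r i)) :=
      hQ.height_pos (by rw [h]; exact hQ.finRotate_finRotate_ne j)
        (by rw [h]; exact hQ.finRotate_ne _)
    positivity
  · have : 0 < height Q j (Q i) := hQ.height_pos hij.symm h
    positivity

lemma IsConvexPolygon.openSide_disjoint (hQ : IsConvexPolygon Q) {i j : Fin r} {p : Plane}
    (hi : p ∈ openSide Q i) (hj : p ∈ openSide Q j) : i = j := by
  by_contra h
  exact (hQ.height_pos_of_mem_openSide h hj).ne' (height_openSide hi)

/-! ### Counting sign changes on a convex set -/

section SignChanges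

variable {E : Type*} [NormedAddCommGroup E] [NormedSpace ℝ E] {C : Set E}

lemma exists_eq_zero_of_convex (hC : Convex ℝ C) (f : E →ₗ[ℝ] ℝ) {x y : E} (hx : x ∈ C)
    (hy : y ∈ C) (hfx : 0 < f x) (hfy : f y < 0) : ∃ z ∈ C, f z = 0 := by
  have hd : 0 < f x - f y := by linarith
  refine ⟨(-f y / (f x - f y)) • x + (f x / (f x - f y)) • y,
    hC hx hy (div_nonneg (by linarith) hd.le) (by positivity) (by field_simp; ring), ?_⟩
  simp only [map_add, map_smul, smul_eq_mul]
  field_simp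
  ring

lemma exists_pos_and_neg_of_isOpen (hC : IsOpen C) (f : E →ₗ[ℝ] ℝ) {x u : E} (hx : x ∈ C)
    (hfx : f x = 0) (hu : f u ≠ 0) : (∃ y ∈ C, 0 < f y) ∧ ∃ y ∈ C, f y < 0 := by
  wlog h : 0 < f u generalizing u
  · exact this (u := -u) (by simpa using hu) (by
      rw [map_neg]; exact neg_pos.2 (lt_of_le_of_ne (not_lt.1 h) hu))
  have hcont : Continuous fun t : ℝ => x + t • u := by fun_prop
  have hev : ∀ᶠ t : ℝ in 𝓝 0, x + t • u ∈ C :=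
    hcont.continuousAt.eventually_mem (by simpa using hC.mem_nhds hx)
  obtain ⟨t, ht, ht0⟩ := ((hev.filter_mono nhdsWithin_le_nhds).and
      (self_mem_nhdsWithin : Ioi (0 : ℝ) ∈ 𝓝[>] 0)).exists
  obtain ⟨s, hs, hs0⟩ := ((hev.filter_mono nhdsWithin_le_nhds).and
      (self_mem_nhdsWithin : Iio (0 : ℝ) ∈ 𝓝[<] 0)).exists
  refine ⟨⟨_, ht, ?_⟩, ⟨_, hs, ?_⟩⟩
  · simp only [map_add, map_smul, smul_eq_mul, hfx, zero_add]
    exact mul_pos ht0 h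
  · simp only [map_add, map_smul, smul_eq_mul, hfx, zero_add]
    exact mul_neg_of_neg_of_pos hs0 h

/-- If `f` is positive and `g` is negative somewhere on a convex set on which `g` is nonnegative
only where `f` is positive, then both happen at the same point: the segment that joins the two
points meets `g = 0`, where `f > 0`, and a small step from there makes `g` negative. -/
lemma exists_pos_neg_of_convex (hC : Convex ℝ C) (f g : E →ₗ[ℝ] ℝ)
    (hfg : ∀ x ∈ C, f x ≤ 0 → g x < 0) {x y : E} (hx : x ∈ C) (hy : y ∈ C) (hfx : 0 < f x)
    (hgy : g y < 0) : ∃ z ∈ C, 0 < f z ∧ g z < 0 := by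
  by_cases hgx : g x < 0
  · exact ⟨x, hx, hfx, hgx⟩
  by_cases hfy : 0 < f y
  · exact ⟨y, hy, hfy, hgy⟩
  obtain ⟨z, hz, hgz⟩ : ∃ z ∈ C, g z = 0 := by
    rcases (not_lt.1 hgx).eq_or_lt with h | h
    · exact ⟨x, hx, h.symm⟩
    · exact exists_eq_zero_of_convex hC g hx hy h hgy
  have hfz : 0 < f z := by
    by_contra h
    exact (hfg z hz (not_lt.1 h)).ne hgz
  have hd : 0 < f z - f y := by linarith
  set t := f z / (2 * (f z - f y)) with ht
  have ht0 : 0 < t := by positivity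
  have ht1 : t * (f z - f y) = f z / 2 := by rw [ht]; field_simp
  have ht2 : t ≤ 1 := by rw [ht, div_le_one (by positivity)]; linarith
  refine ⟨(1 - t) • z + t • y, hC hz hy (by linarith) ht0.le (by ring), ?_, ?_⟩
  · simp only [map_add, map_smul, smul_eq_mul]; nlinarith
  · simp only [map_add, map_smul, smul_eq_mul, hgz]; nlinarith

open Classical in
/-- Let `f 0, …, f N` be linear functionals whose signs, at every point of the open convex set `C`,
change exactly once, from plus to minus. Then the number of indices at which the change occurs
exceeds by one the number of functionals that vanish somewhere on `C`: the zero sets of these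
functionals cut `C` into consecutive strips. -/
lemma card_sign_changes (hC : Convex ℝ C) (hCo : IsOpen C) (hne : C.Nonempty)
    (f : ℕ → E →ₗ[ℝ] ℝ) {N : ℕ} (h0 : ∀ x ∈ C, 0 < f 0 x) (hN : ∀ x ∈ C, f N x < 0)
    (hstep : ∀ k < N, ∀ x ∈ C, f k x ≤ 0 → f (k + 1) x < 0)
    (hgen : ∀ k, 0 < k → k < N → ∀ x ∈ C, f k x = 0 → ∃ u, f k u ≠ 0) :
    ((Finset.range N).filter fun k => ∃ x ∈ C, 0 < f k x ∧ f (k + 1) x < 0).card =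
      ((Finset.range N).filter fun k => 0 < k ∧ ∃ x ∈ C, f k x = 0).card + 1 := by
  obtain ⟨x₀, hx₀⟩ := hne
  set Pos : ℕ → Prop := fun k => ∃ x ∈ C, 0 < f k x with hPos
  set Neg : ℕ → Prop := fun k => ∃ x ∈ C, f k x < 0 with hNeg
  have hPosN : ¬ Pos N := fun ⟨x, hx, h⟩ => (hN x hx).not_gt h
  have hNeg0 : ¬ Neg 0 := fun ⟨x, hx, h⟩ => (h0 x hx).not_gt h
  have hP0 : Pos 0 := ⟨x₀, hx₀, h0 x₀ hx₀⟩
  have hNN : ∃ k, Neg k := ⟨N, x₀, hx₀, hN x₀ hx₀⟩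
  have hPanti : ∀ k < N, Pos (k + 1) → Pos k := by
    rintro k hk ⟨x, hx, h⟩
    refine ⟨x, hx, ?_⟩
    by_contra hcon
    exact (hstep k hk x hx (not_lt.1 hcon)).not_gt h
  have hNmono : ∀ k < N, Neg k → Neg (k + 1) := by
    rintro k hk ⟨x, hx, h⟩
    exact ⟨x, hx, hstep k hk x hx h.le⟩
  have hPN : ∀ k ≤ N, Pos k ∨ Neg k := by
    intro k hk
    rcases lt_trichotomy (f k x₀) 0 with h | h | h
    · exact Or.inr ⟨x₀, hx₀, h⟩
    · have hk0 : 0 < k := by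
        rcases Nat.eq_zero_or_pos k with rfl | h'
        · exact absurd h (h0 x₀ hx₀).ne'
        · exact h'
      have hkN : k < N := by
        rcases hk.eq_or_lt with rfl | h'
        · exact absurd h (hN x₀ hx₀).ne
        · exact h'
      obtain ⟨u, hu⟩ := hgen k hk0 hkN x₀ hx₀ h
      exact Or.inl (exists_pos_and_neg_of_isOpen hCo (f k) hx₀ h hu).1
    · exact Or.inl ⟨x₀, hx₀, h⟩
  set a := Nat.find hNN with ha
  set b := Nat.findGreatest Pos N with hb
  have hPb : Pos b := Nat.findGreatest_spec (Nat.zero_le N) hP0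
  have hbN : b < N := by
    rcases (Nat.findGreatest_le (P := Pos) N).eq_or_lt with h | h
    · rw [← hb] at h; exact absurd (h ▸ hPb) hPosN
    · exact h
  have hNa : Neg a := Nat.find_spec hNN
  have haN : a ≤ N := Nat.find_min' hNN ⟨x₀, hx₀, hN x₀ hx₀⟩
  have ha0 : 0 < a := by
    rcases Nat.eq_zero_or_pos a with h | h
    · exact absurd (h ▸ hNa) hNeg0
    · exact h
  have hPiff : ∀ k ≤ N, Pos k ↔ k ≤ b := by
    intro k hk
    refine ⟨fun h => Nat.le_findGreatest hk h, fun h => ?_⟩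
    exact Nat.decreasingInduction' (P := Pos) (fun l hl _ hP => hPanti l (by omega) hP) h hPb
  have hNiff : ∀ k ≤ N, Neg k ↔ a ≤ k := by
    intro k hk
    refine ⟨fun h => Nat.find_min' hNN h, fun h => ?_⟩
    induction k, h using Nat.le_induction with
    | base => exact hNa
    | succ l hl ih => exact hNmono l hk (ih (by omega))
  have hab : a ≤ b + 1 := by
    rcases hPN (b + 1) hbN with h | h
    · have := (hPiff (b + 1) hbN).1 h; omega
    · exact (hNiff (b + 1) hbN).1 h
  have hcells : (Finset.range N).filter (fun k => ∃ x ∈ C, 0 < f k x ∧ f (k + 1) x < 0) =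
      Finset.Icc (a - 1) b := by
    ext k
    simp only [Finset.mem_filter, Finset.mem_range, Finset.mem_Icc]
    constructor
    · rintro ⟨hk, x, hx, h1, h2⟩
      have h1 := (hPiff k hk.le).1 ⟨x, hx, h1⟩
      have h2 := (hNiff (k + 1) hk).1 ⟨x, hx, h2⟩
      omega
    · rintro ⟨h1, h2⟩
      have hk : k < N := by omega
      obtain ⟨x, hx, hfx⟩ := (hPiff k hk.le).2 h2
      obtain ⟨y, hy, hfy⟩ := (hNiff (k + 1) hk).2 (by omega)
      exact ⟨hk, exists_pos_neg_of_convex hC _ _ (hstep k hk) hx hy hfx hfy⟩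
  have hzeros : (Finset.range N).filter (fun k => 0 < k ∧ ∃ x ∈ C, f k x = 0) =
      Finset.Icc a b := by
    ext k
    simp only [Finset.mem_filter, Finset.mem_range, Finset.mem_Icc]
    constructor
    · rintro ⟨hk, hk0, x, hx, h⟩
      obtain ⟨u, hu⟩ := hgen k hk0 hk x hx h
      have := exists_pos_and_neg_of_isOpen hCo (f k) hx h hu
      exact ⟨(hNiff k hk.le).1 this.2, (hPiff k hk.le).1 this.1⟩
    · rintro ⟨h1, h2⟩
      have hk : k < N := by omega
      obtain ⟨x, hx, hfx⟩ := (hPiff k hk.le).2 h2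
      obtain ⟨y, hy, hfy⟩ := (hNiff k hk.le).2 h1
      exact ⟨hk, by omega, exists_eq_zero_of_convex hC _ hx hy hfx hfy⟩
  rw [hcells, hzeros, Nat.card_Icc, Nat.card_Icc]
  omega

end SignChanges

/-! ### Oriented lines -/

/-- An oriented line is encoded by a direction `v`, of arbitrary length, and the moment
`cross p v` of its points `p`. In these coordinates all conditions on the relative position of a
line and a point are linear. The pairs `(0, c)` are not lines; they are kept for linearity. -/
abbrev OrientedLine : Type := Plane × ℝ

/-- The oriented line through `p` with direction `v`. -/
def lineThrough (p v : Plane) : OrientedLine := (v, cross p v)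

/-- The position of the point `p` relative to an oriented line: positive to the right of the line,
negative to the left of it, zero on it. -/
def side (p : Plane) : OrientedLine →ₗ[ℝ] ℝ where
  toFun x := cross p x.1 - x.2
  map_add' x y := by simp [cross_add_right]; ring
  map_smul' a x := by simp [cross_smul_right]; ring

lemma side_apply (p : Plane) (x : OrientedLine) : side p x = cross p x.1 - x.2 := rfl

lemma side_lineThrough (p s v : Plane) : side p (lineThrough s v) = cross (p - s) v := by
  rw [side_apply, lineThrough, cross_sub_left]

/-- The line leaves the polygon through the open side `i`. -/
def Exits (Q : Polygon Plane r) (i : Fin r) (x : OrientedLine) : Prop :=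
  0 < side (Q i) x ∧ side (Q (finRotate r i)) x < 0

/-- The line leaves the polygon through the vertex `b`, after having run through the interior.
Leaving `-x` through a side or a vertex means entering the polygon there along `x`. -/
def ExitsAt (Q : Polygon Plane r) (b : Fin r) (x : OrientedLine) : Prop :=
  0 < side (Q ((finRotate r).symm b)) x ∧ side (Q b) x = 0 ∧ side (Q (finRotate r b)) x < 0

/-- Along consecutive vertices the position relative to a line changes sign only once. This is the
linear relation between four points `a, b, c, d` in convex position, in which the coefficients of
`a` and `c` have one sign and those of `b` and `d` the other. -/
lemma IsConvexPolygon.side_neg_of_side_nonpos (hQ : IsConvexPolygon Q) (m : Fin r) {N k : ℕ}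
    (hN : N < r) (hk : k < N) {x : OrientedLine} (h0 : 0 < side (Q m) x)
    (hlast : side (Q ((finRotate r)^[N] m)) x < 0) (hx : side (Q ((finRotate r)^[k] m)) x ≤ 0) :
    side (Q ((finRotate r)^[k + 1] m)) x < 0 := by
  rcases Nat.eq_zero_or_pos k with rfl | hk0
  · exact absurd h0 (not_lt.2 hx)
  rcases (Nat.succ_le_of_lt hk).eq_or_lt with h | h
  · rw [← h] at hlast; exact hlast
  have h : k + 1 < N := h
  by_contra! hc
  have p1 := hQ.triple_pos m (a := k) (b := k + 1) (c := N) (by omega) h (by omega)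
  have p2 := hQ.triple_pos m (a := 0) (b := k) (c := N) hk0 hk (by omega)
  have p3 := hQ.triple_pos m (a := 0) (b := k + 1) (c := N) (by omega) h (by omega)
  have p4 := hQ.triple_pos m (a := 0) (b := k) (c := k + 1) hk0 (by omega) (by omega)
  simp only [Function.iterate_zero, id_eq] at p1 p2 p3 p4
  set A := Q m
  set B := Q ((finRotate r)^[k] m)
  set C := Q ((finRotate r)^[k + 1] m)
  set D := Q ((finRotate r)^[N] m)
  have key : cross (C - B) (D - B) * side A x + cross (B - A) (D - A) * side C x =
      cross (C - A) (D - A) * side B x + cross (B - A) (C - A) * side D x := by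
    simp only [side_apply, cross, PiLp.sub_apply]; ring
  have l1 : 0 < cross (C - B) (D - B) * side A x := mul_pos p1 h0
  have l2 : 0 ≤ cross (B - A) (D - A) * side C x := mul_nonneg p2.le hc
  have l3 : cross (C - A) (D - A) * side B x ≤ 0 := mul_nonpos_of_nonneg_of_nonpos p3.le hx
  have l4 : cross (B - A) (C - A) * side D x < 0 := mul_neg_of_pos_of_neg p4 hlast
  linarith

open Classical in
/-- Let `C` parametrize an open convex family of lines that have the vertex `m` strictly to their
right, the vertex `N` steps further strictly to their left and none of the remaining vertices to
their right. The number of sides through which these lines leave the polygon exceeds by one the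
number of vertices through which they do. The family enters through the side before `m` if
`N = r - 1`, and through the vertex before `m` if `N = r - 2`. -/
lemma IsConvexPolygon.card_exits (hQ : IsConvexPolygon Q) {E : Type*} [NormedAddCommGroup E]
    [NormedSpace ℝ E] {C : Set E} (hC : Convex ℝ C) (hCo : IsOpen C) (hne : C.Nonempty)
    (ℓ : E →ₗ[ℝ] OrientedLine) (m : Fin r) {N : ℕ} (hNr : N < r)
    (h0 : ∀ x ∈ C, 0 < side (Q m) (ℓ x))
    (hlast : ∀ x ∈ C, side (Q ((finRotate r)^[N] m)) (ℓ x) < 0)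
    (hrest : ∀ x ∈ C, ∀ k, N < k → k < r → side (Q ((finRotate r)^[k] m)) (ℓ x) ≤ 0)
    (hgen : ∀ b, ∀ x ∈ C, ExitsAt Q b (ℓ x) → ∃ u, side (Q b) (ℓ u) ≠ 0) :
    (Finset.univ.filter fun j => ∃ x ∈ C, Exits Q j (ℓ x)).card =
      (Finset.univ.filter fun b => ∃ x ∈ C, ExitsAt Q b (ℓ x)).card + 1 := by
  set f : ℕ → E →ₗ[ℝ] ℝ := fun k => (side (Q ((finRotate r)^[k] m))).comp ℓ with hf
  have hinj : InjOn (fun k => (finRotate r)^[k] m) (Finset.range N : Set ℕ) := by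
    intro k hk l hl h
    simp only [Finset.coe_range, mem_Iio] at hk hl
    rcases lt_trichotomy k l with h' | h' | h'
    · exact absurd h (finRotate_iterate_ne m h' (by omega))
    · exact h'
    · exact absurd h.symm (finRotate_iterate_ne m h' (by omega))
  have hstep : ∀ k < N, ∀ x ∈ C, f k x ≤ 0 → f (k + 1) x < 0 := fun k hk x hx h =>
    hQ.side_neg_of_side_nonpos m hNr hk (h0 x hx) (hlast x hx) h
  have hsymm : ∀ k, (finRotate r).symm ((finRotate r)^[k + 1] m) = (finRotate r)^[k] m := by
    intro k
    rw [Function.iterate_succ_apply', Equiv.symm_apply_apply]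
  have hat : ∀ k, 0 < k → k < N → ∀ x ∈ C, f k x = 0 →
      ExitsAt Q ((finRotate r)^[k] m) (ℓ x) := by
    intro k hk0 hk x hx h
    refine ⟨?_, h, ?_⟩
    · obtain ⟨k, rfl⟩ : ∃ l, k = l + 1 := ⟨k - 1, by omega⟩
      rw [hsymm]
      by_contra hcon
      exact (hstep k (by omega) x hx (not_lt.1 hcon)).ne h
    · rw [← Function.iterate_succ_apply' (finRotate r)]
      exact hstep k hk x hx h.le
  have hnonpos : ∀ x ∈ C, ∀ k, N ≤ k → k < r → f k x ≤ 0 := by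
    intro x hx k h1 h2
    rcases h1.eq_or_lt with rfl | h
    · exact (hlast x hx).le
    · exact hrest x hx k h h2
  have hcount := card_sign_changes hC hCo hne f h0 hlast hstep
    (fun k hk0 hk x hx h => hgen _ x hx (hat k hk0 hk x hx h))
  have e1 : (Finset.univ.filter fun j => ∃ x ∈ C, Exits Q j (ℓ x)) =
      ((Finset.range N).filter fun k => ∃ x ∈ C, 0 < f k x ∧ f (k + 1) x < 0).image
        fun k => (finRotate r)^[k] m := by
    ext j
    simp only [Finset.mem_filter, Finset.mem_univ, true_and, Finset.mem_image, Finset.mem_range]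
    constructor
    · rintro ⟨x, hx, h1, h2⟩
      obtain ⟨k, hk, rfl⟩ := exists_finRotate_iterate m j
      refine ⟨k, ⟨?_, x, hx, h1, ?_⟩, rfl⟩
      · by_contra hcon
        exact (hnonpos x hx k (not_lt.1 hcon) hk).not_gt h1
      · simpa only [hf, LinearMap.comp_apply, Function.iterate_succ_apply'] using h2
    · rintro ⟨k, ⟨hk, x, hx, h1, h2⟩, rfl⟩
      refine ⟨x, hx, h1, ?_⟩
      simpa only [hf, LinearMap.comp_apply, Function.iterate_succ_apply'] using h2
  have e2 : (Finset.univ.filter fun b => ∃ x ∈ C, ExitsAt Q b (ℓ x)) =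
      ((Finset.range N).filter fun k => 0 < k ∧ ∃ x ∈ C, f k x = 0).image
        fun k => (finRotate r)^[k] m := by
    ext j
    simp only [Finset.mem_filter, Finset.mem_univ, true_and, Finset.mem_image, Finset.mem_range]
    constructor
    · rintro ⟨x, hx, h1, h2, h3⟩
      obtain ⟨k, hk, rfl⟩ := exists_finRotate_iterate m j
      have hk0 : 0 < k := by
        rcases Nat.eq_zero_or_pos k with rfl | h
        · exact absurd h2 (h0 x hx).ne'
        · exact h
      refine ⟨k, ⟨?_, hk0, x, hx, h2⟩, rfl⟩
      by_contra hcon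
      rcases (not_lt.1 hcon).eq_or_lt with rfl | h
      · exact (hlast x hx).ne h2
      · obtain ⟨k, rfl⟩ : ∃ l, k = l + 1 := ⟨k - 1, by omega⟩
        rw [hsymm] at h1
        exact (hnonpos x hx k (by omega) (by omega)).not_gt h1
    · rintro ⟨k, ⟨hk, hk0, x, hx, h⟩, rfl⟩
      exact ⟨x, hx, hat k hk0 hk x hx h⟩
  rw [e1, e2, Finset.card_image_of_injOn, Finset.card_image_of_injOn, hcount]
  · exact hinj.mono (Finset.coe_subset.2 (Finset.filter_subset _ _))
  · exact hinj.mono (Finset.coe_subset.2 (Finset.filter_subset _ _))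

/-! ### Reflections of lines and itineraries -/

lemma mirror_eq (i : Fin r) (v : Plane) :
    mirror Q i v = (2 * (inner ℝ (edge Q i) v / ‖edge Q i‖ ^ 2)) • edge Q i - v := by
  have := Submodule.reflection_singleton_apply (𝕜 := ℝ) (edge Q i) v
  rw [mirror]
  change (Submodule.span ℝ {edge Q i}).reflection v = _
  rw [this, mul_smul, two_smul ℝ, two_smul ℕ]
  rfl

lemma mirror_add (i : Fin r) (u v : Plane) : mirror Q i (u + v) = mirror Q i u + mirror Q i v :=
  map_add _ u v

lemma mirror_smul (i : Fin r) (a : ℝ) (v : Plane) : mirror Q i (a • v) = a • mirror Q i v :=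
  map_smul _ a v

@[simp] lemma mirror_mirror (i : Fin r) (v : Plane) : mirror Q i (mirror Q i v) = v :=
  Submodule.reflection_reflection _ v

@[simp] lemma norm_mirror (i : Fin r) (v : Plane) : ‖mirror Q i v‖ = ‖v‖ :=
  LinearIsometryEquiv.norm_map _ v

lemma mirror_edge (i : Fin r) : mirror Q i (edge Q i) = edge Q i :=
  Submodule.reflection_mem_subspace_eq_self (Submodule.mem_span_singleton_self _)

lemma cross_edge_mirror (i : Fin r) (v : Plane) :
    cross (edge Q i) (mirror Q i v) = -cross (edge Q i) v := by
  rw [mirror_eq, cross_sub_right, cross_smul_right, cross_self]; ring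

/-- A reflection has determinant `-1`. -/
lemma IsConvexPolygon.cross_mirror_right (hQ : IsConvexPolygon Q) (i : Fin r) (u v : Plane) :
    cross u (mirror Q i v) = -cross (mirror Q i u) v := by
  have he : ‖edge Q i‖ ^ 2 = edge Q i 0 ^ 2 + edge Q i 1 ^ 2 := by
    rw [EuclideanSpace.real_norm_sq_eq, Fin.sum_univ_two]
  have hpos : ‖edge Q i‖ ^ 2 ≠ 0 := by
    have := norm_pos_iff.2 (hQ.edge_ne_zero i); positivity
  have hu : inner ℝ (edge Q i) u = edge Q i 0 * u 0 + edge Q i 1 * u 1 := by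
    simp [PiLp.inner_apply, Fin.sum_univ_two, mul_comm]
  have hv : inner ℝ (edge Q i) v = edge Q i 0 * v 0 + edge Q i 1 * v 1 := by
    simp [PiLp.inner_apply, Fin.sum_univ_two, mul_comm]
  have key : inner ℝ (edge Q i) v * cross u (edge Q i) + inner ℝ (edge Q i) u * cross (edge Q i) v =
      ‖edge Q i‖ ^ 2 * cross u v := by
    rw [hu, hv, he]; simp only [cross]; ring
  rw [mirror_eq, mirror_eq, cross_sub_right, cross_sub_left, cross_smul_right, cross_smul_left]
  have : inner ℝ (edge Q i) v / ‖edge Q i‖ ^ 2 * cross u (edge Q i) +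
      inner ℝ (edge Q i) u / ‖edge Q i‖ ^ 2 * cross (edge Q i) v = cross u v := by
    rw [div_mul_eq_mul_div, div_mul_eq_mul_div, ← add_div, key, mul_div_cancel_left₀ _ hpos]
  linarith

/-- The image of an oriented line under the reflection in the line that carries the side `i`. -/
def reflectLine (Q : Polygon Plane r) (i : Fin r) : OrientedLine →ₗ[ℝ] OrientedLine where
  toFun x := (mirror Q i x.1, cross (Q i) (mirror Q i x.1) + cross (Q i) x.1 - x.2)
  map_add' x y := by
    ext1
    · simp [mirror_add]
    · simp only [Prod.fst_add, Prod.snd_add, mirror_add, cross_add_right]; ring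
  map_smul' a x := by
    ext1
    · simp [mirror_smul]
    · simp only [Prod.smul_fst, Prod.smul_snd, mirror_smul, cross_smul_right, smul_eq_mul,
        RingHom.id_apply]
      ring

lemma reflectLine_apply (i : Fin r) (x : OrientedLine) : reflectLine Q i x =
    (mirror Q i x.1, cross (Q i) (mirror Q i x.1) + cross (Q i) x.1 - x.2) := rfl

@[simp] lemma reflectLine_reflectLine (i : Fin r) (x : OrientedLine) :
    reflectLine Q i (reflectLine Q i x) = x := by
  simp only [reflectLine_apply, mirror_mirror]
  ext1
  · rfl
  · simp only; ring

/-- The image of a point under the reflection in the line that carries the side `i`. -/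
def reflectPoint (Q : Polygon Plane r) (i : Fin r) (p : Plane) : Plane :=
  Q i + mirror Q i (p - Q i)

lemma reflectPoint_add_smul (i : Fin r) (p v : Plane) (t : ℝ) :
    reflectPoint Q i (p + t • v) = reflectPoint Q i p + t • mirror Q i v := by
  rw [reflectPoint, add_sub_right_comm, mirror_add, mirror_smul, reflectPoint]; abel

lemma IsConvexPolygon.reflectPoint_eq_self (hQ : IsConvexPolygon Q) {i : Fin r} {p : Plane}
    (hp : height Q i p = 0) : reflectPoint Q i p = p := by
  obtain ⟨t, ht⟩ := exists_eq_smul_of_cross_eq_zero (hQ.edge_ne_zero i) (u := p - Q i)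
    (by rw [cross_swap]; exact neg_eq_zero.2 hp)
  rw [reflectPoint, ht, mirror_smul, mirror_edge, ← ht]; abel

/-- A reflection exchanges the two sides of a line, as it reverses the orientation. -/
lemma IsConvexPolygon.side_reflectLine (hQ : IsConvexPolygon Q) (i : Fin r) (p : Plane)
    (x : OrientedLine) : side p (reflectLine Q i x) = -side (reflectPoint Q i p) x := by
  have := hQ.cross_mirror_right i (p - Q i) x.1
  rw [cross_sub_left] at this
  rw [side_apply, side_apply, reflectLine_apply, reflectPoint, cross_add_left]
  simp only
  linarith

lemma IsConvexPolygon.side_reflectLine_start (hQ : IsConvexPolygon Q) (i : Fin r)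
    (x : OrientedLine) : side (Q i) (reflectLine Q i x) = -side (Q i) x := by
  rw [hQ.side_reflectLine, hQ.reflectPoint_eq_self (height_start i)]

lemma IsConvexPolygon.side_reflectLine_end (hQ : IsConvexPolygon Q) (i : Fin r)
    (x : OrientedLine) :
    side (Q (finRotate r i)) (reflectLine Q i x) = -side (Q (finRotate r i)) x := by
  rw [hQ.side_reflectLine, hQ.reflectPoint_eq_self (height_end i)]

lemma IsConvexPolygon.reflectLine_lineThrough (hQ : IsConvexPolygon Q) {i : Fin r} {p : Plane}
    (hp : height Q i p = 0) (v : Plane) :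
    reflectLine Q i (lineThrough p v) = lineThrough p (mirror Q i v) := by
  have h : side p (reflectLine Q i (lineThrough p v)) = 0 := by
    rw [hQ.side_reflectLine, hQ.reflectPoint_eq_self hp, side_lineThrough]; simp
  rw [side_apply, sub_eq_zero] at h
  exact Prod.ext rfl h.symm

/-- The line leaves the polygon through the first side of the list, after reflection there it leaves
the polygon through the second one, and so on. -/
def Follows (Q : Polygon Plane r) : List (Fin r) → OrientedLine → Prop
  | [], _ => True
  | i :: w, x => Exits Q i x ∧ Follows Q w (reflectLine Q i x)

/-- The line obtained by successive reflection in the sides of the list. -/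
def transport (Q : Polygon Plane r) : List (Fin r) → OrientedLine →ₗ[ℝ] OrientedLine
  | [] => LinearMap.id
  | i :: w => (transport Q w).comp (reflectLine Q i)

/-- The image of a point of the last copy of the table in the unfolding along the list of sides. -/
def unfold (Q : Polygon Plane r) : List (Fin r) → Plane → Plane
  | [], p => p
  | i :: w, p => reflectPoint Q i (unfold Q w p)

@[simp] lemma transport_nil (x : OrientedLine) : transport Q [] x = x := rfl

@[simp] lemma transport_cons (i : Fin r) (w : List (Fin r)) (x : OrientedLine) :
    transport Q (i :: w) x = transport Q w (reflectLine Q i x) := rfl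

lemma transport_append_singleton (w : List (Fin r)) (i : Fin r) (x : OrientedLine) :
    transport Q (w ++ [i]) x = reflectLine Q i (transport Q w x) := by
  induction w generalizing x with
  | nil => rfl
  | cons j w ih => exact ih _

lemma follows_append_singleton (w : List (Fin r)) (i : Fin r) (x : OrientedLine) :
    Follows Q (w ++ [i]) x ↔ Follows Q w x ∧ Exits Q i (transport Q w x) := by
  induction w generalizing x with
  | nil => simp [Follows]
  | cons j w ih => simp only [List.cons_append, Follows, ih, transport_cons, and_assoc]

lemma IsConvexPolygon.side_transport (hQ : IsConvexPolygon Q) (w : List (Fin r)) (p : Plane)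
    (x : OrientedLine) :
    side p (transport Q w x) = (-1) ^ w.length * side (unfold Q w p) x := by
  induction w generalizing x with
  | nil => simp [unfold]
  | cons i w ih =>
    rw [transport_cons, ih, hQ.side_reflectLine, unfold, List.length_cons, pow_succ]; ring

lemma convex_setOf_exits (i : Fin r) : Convex ℝ {x | Exits Q i x} :=
  (convex_halfSpace_gt (side _).isLinear 0).inter (convex_halfSpace_lt (side _).isLinear 0)

lemma isOpen_setOf_exits (i : Fin r) : IsOpen {x | Exits Q i x} :=
  (isOpen_lt continuous_const (side _).continuous_of_finiteDimensional).inter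
    (isOpen_lt (side _).continuous_of_finiteDimensional continuous_const)

lemma convex_setOf_follows (w : List (Fin r)) : Convex ℝ {x | Follows Q w x} := by
  induction w with
  | nil => simpa [Follows] using (convex_univ : Convex ℝ (univ : Set OrientedLine))
  | cons i w ih => exact (convex_setOf_exits i).inter (ih.linear_preimage (reflectLine Q i))

lemma isOpen_setOf_follows (w : List (Fin r)) : IsOpen {x | Follows Q w x} := by
  induction w with
  | nil => simp [Follows]
  | cons i w ih =>
    exact (isOpen_setOf_exits i).inter
      (ih.preimage (reflectLine Q i).continuous_of_finiteDimensional)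

lemma Exits.smul {i : Fin r} {x : OrientedLine} (h : Exits Q i x) {a : ℝ} (ha : 0 < a) :
    Exits Q i (a • x) := by
  refine ⟨?_, ?_⟩
  · rw [map_smul]; exact mul_pos ha h.1
  · rw [map_smul]; exact mul_neg_of_pos_of_neg ha h.2

lemma Follows.smul {w : List (Fin r)} {x : OrientedLine} (h : Follows Q w x) {a : ℝ}
    (ha : 0 < a) : Follows Q w (a • x) := by
  induction w generalizing x with
  | nil => trivial
  | cons i w ih => exact ⟨h.1.smul ha, by rw [map_smul]; exact ih h.2⟩

lemma ExitsAt.smul {b : Fin r} {x : OrientedLine} (h : ExitsAt Q b x) {a : ℝ} (ha : 0 < a) :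
    ExitsAt Q b (a • x) := by
  refine ⟨?_, ?_, ?_⟩
  · rw [map_smul]; exact mul_pos ha h.1
  · rw [map_smul, h.2.1, smul_zero]
  · rw [map_smul]; exact mul_neg_of_pos_of_neg ha h.2.2

/-- After the last reflection the line enters the polygon through the last side. -/
lemma IsConvexPolygon.exits_neg_transport (hQ : IsConvexPolygon Q) {w : List (Fin r)} {i : Fin r}
    {x : OrientedLine} (h : Follows Q (w ++ [i]) x) : Exits Q i (-transport Q (w ++ [i]) x) := by
  have h' := ((follows_append_singleton w i x).1 h).2
  rw [transport_append_singleton]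
  refine ⟨?_, ?_⟩
  · rw [map_neg, hQ.side_reflectLine_start, neg_neg]; exact h'.1
  · rw [map_neg, hQ.side_reflectLine_end, neg_neg]; exact h'.2

/-! ### Orbits and itineraries -/

/-- The oriented line along which the ball in the phase point `x` moves. -/
def lineOf (x : Plane × Plane) : OrientedLine := lineThrough x.1 x.2

/-- The vector `v` points from `p` into the interior of the table. -/
def Inward (Q : Polygon Plane r) (p v : Plane) : Prop :=
  ∃ ε : ℝ, 0 < ε ∧ ∀ t ∈ Ioo 0 ε, p + t • v ∈ inside Q

lemma IsConvexPolygon.inward_iff (hQ : IsConvexPolygon Q) {p v : Plane}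
    (hp : ∀ i, 0 ≤ height Q i p) :
    Inward Q p v ↔ ∀ i, height Q i p = 0 → 0 < cross (edge Q i) v := by
  constructor
  · rintro ⟨ε, hε, h⟩ i hi
    have := hQ.mem_inside_iff.1 (h (ε / 2) ⟨by positivity, by linarith⟩) i
    rw [height_add_smul, hi, zero_add] at this
    exact (mul_pos_iff_of_pos_left (by positivity)).1 this
  · intro h
    have hev : ∀ i, ∀ᶠ t : ℝ in 𝓝[>] 0, 0 < height Q i (p + t • v) := by
      intro i
      rcases (hp i).eq_or_lt with hi | hi
      · filter_upwards [self_mem_nhdsWithin] with t ht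
        have ht : 0 < t := ht
        rw [height_add_smul, ← hi, zero_add]
        exact mul_pos ht (h i hi.symm)
      · have hcont : Continuous fun t : ℝ => height Q i (p + t • v) :=
          (continuous_height i).comp (by fun_prop)
        exact (hcont.continuousAt.eventually_mem
          (isOpen_Ioi.mem_nhds (by simpa using hi))).filter_mono nhdsWithin_le_nhds
    obtain ⟨ε, hε, hsub⟩ := mem_nhdsGT_iff_exists_Ioo_subset.1 (eventually_all.2 hev)
    exact ⟨ε, hε, fun t ht => hQ.mem_inside_iff.2 (hsub ht)⟩

lemma IsConvexPolygon.inward_iff_of_mem_openSide (hQ : IsConvexPolygon Q) {i : Fin r} {p v : Plane}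
    (hp : p ∈ openSide Q i) : Inward Q p v ↔ 0 < cross (edge Q i) v := by
  rw [hQ.inward_iff (hQ.height_nonneg_of_mem_boundary (openSide_subset_boundary hp))]
  refine ⟨fun h => h i (height_openSide hp), fun h j hj => ?_⟩
  by_cases hji : j = i
  · rwa [hji]
  · exact absurd hj (hQ.height_pos_of_mem_openSide hji hp).ne'

lemma IsConvexPolygon.inward_vertex_iff (hQ : IsConvexPolygon Q) {a : Fin r} {v : Plane} :
    Inward Q (Q a) v ↔ ExitsAt Q a (-lineThrough (Q a) v) := by
  rw [hQ.inward_iff fun i => hQ.height_nonneg i a]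
  have h1 : side (Q (finRotate r a)) (-lineThrough (Q a) v) = -cross (edge Q a) v := by
    rw [map_neg, side_lineThrough]; rfl
  have h2 : side (Q ((finRotate r).symm a)) (-lineThrough (Q a) v) =
      cross (edge Q ((finRotate r).symm a)) v := by
    rw [map_neg, side_lineThrough, edge, Equiv.apply_symm_apply, cross_sub_left, cross_sub_left]
    ring
  have h3 : side (Q a) (-lineThrough (Q a) v) = 0 := by
    rw [map_neg, side_lineThrough]; simp
  rw [ExitsAt, h1, h2, h3]
  constructor
  · intro h
    refine ⟨h _ ?_, rfl, neg_neg_of_pos (h a (height_start a))⟩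
    nth_rw 2 [← (finRotate r).apply_symm_apply a]
    exact height_end _
  · rintro ⟨h4, -, h5⟩ i hi
    by_cases hia : a = i
    · rw [← hia]; linarith
    by_cases hib : a = finRotate r i
    · rwa [hib, Equiv.symm_apply_apply] at h4
    · exact absurd hi (hQ.height_pos hia hib).ne'

lemma side_convexCombo (p q : Plane) (x : OrientedLine) {a b : ℝ} (hab : a + b = 1) :
    side (a • p + b • q) x = a * side p x + b * side q x := by
  simp only [side_apply, cross_add_left, cross_smul_left]
  linear_combination x.2 * hab

lemma exists_exit_point {j : Fin r} {x : OrientedLine} (h : Exits Q j x) :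
    ∃ s ∈ openSide Q j, side s x = 0 ∧ cross (edge Q j) x.1 < 0 := by
  obtain ⟨h1, h2⟩ := h
  set A := side (Q j) x with hA
  set B := side (Q (finRotate r j)) x with hB
  have hd : 0 < A - B := by linarith
  have hsum : -B / (A - B) + A / (A - B) = 1 := by field_simp; ring
  refine ⟨(-B / (A - B)) • Q j + (A / (A - B)) • Q (finRotate r j),
    ⟨_, _, div_pos (by linarith) hd, div_pos h1 hd, hsum, rfl⟩, ?_, ?_⟩
  · rw [side_convexCombo _ _ _ hsum, ← hA, ← hB]; ring
  · have : cross (edge Q j) x.1 = B - A := by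
      simp only [A, B, edge, cross_sub_left, side_apply]; ring
    linarith

lemma exits_lineThrough_iff {j : Fin r} {s v : Plane} (hs : s ∈ openSide Q j) :
    Exits Q j (lineThrough s v) ↔ cross (edge Q j) v < 0 := by
  obtain ⟨a, b, ha, hb, hab, rfl⟩ := hs
  have e1 : Q j - (a • Q j + b • Q (finRotate r j)) = (-b) • edge Q j := by
    rw [edge, show a = 1 - b by linarith]; module
  have e2 : Q (finRotate r j) - (a • Q j + b • Q (finRotate r j)) = a • edge Q j := by
    rw [edge, show b = 1 - a by linarith]; module
  rw [Exits, side_lineThrough, side_lineThrough, e1, e2, cross_smul_left, cross_smul_left]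
  exact ⟨fun h => (pos_iff_neg_of_mul_neg h.2).1 ha,
    fun h => ⟨mul_pos_of_neg_of_neg (by linarith) h, mul_neg_of_pos_of_neg ha h⟩⟩

/-- The ball reaches every boundary point `s'` on its line at which the line points outwards. -/
lemma IsConvexPolygon.reaches_of_cross_neg (hQ : IsConvexPolygon Q) {s s' v : Plane}
    (hs : s ∈ Q.boundary ℝ) (hv : Inward Q s v) (hs' : s' ∈ Q.boundary ℝ)
    (hline : cross (s' - s) v = 0) {j : Fin r} (hj : height Q j s' = 0)
    (hneg : cross (edge Q j) v < 0) : Reaches Q (s, v) s' := by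
  have hv0 : v ≠ 0 := by rintro rfl; simp at hneg
  obtain ⟨t, ht⟩ := exists_eq_smul_of_cross_eq_zero hv0 hline
  have hs'eq : s' = s + t • v := by rw [← ht]; abel
  have hpos := hQ.height_nonneg_of_mem_boundary hs
  have ht0 : 0 < t := by
    rw [hs'eq, height_add_smul] at hj
    by_contra hcon
    have h1 : 0 ≤ t * cross (edge Q j) v :=
      mul_nonneg_of_nonpos_of_nonpos (not_lt.1 hcon) hneg.le
    have h2 := hpos j
    exact ((hQ.inward_iff hpos).1 hv j (by linarith)).not_gt hneg
  refine ⟨hs', ⟨t, ht0, hs'eq⟩, ?_⟩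
  rintro _ ⟨a, b, ha, hb, hab, rfl⟩
  rw [hQ.mem_inside_iff]
  intro i
  rw [height_convexCombo i _ _ hab]
  have h1 := hpos i
  have h2 := hQ.height_nonneg_of_mem_boundary hs' i
  rcases h1.eq_or_lt with h | h
  · have h3 : 0 < height Q i s' := by
      rw [hs'eq, height_add_smul, ← h, zero_add]
      exact mul_pos ht0 ((hQ.inward_iff hpos).1 hv i h.symm)
    positivity
  · positivity

lemma IsConvexPolygon.cross_neg_of_reaches (hQ : IsConvexPolygon Q) {s s' v : Plane}
    (h : Reaches Q (s, v) s') {j : Fin r} (hj : height Q j s' = 0) : cross (edge Q j) v < 0 := by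
  obtain ⟨-, ⟨t, ht, hs'⟩, hsub⟩ := h
  simp only at hs' hsub
  have hmem : s + (t / 2) • v ∈ openSegment ℝ s s' :=
    ⟨1 / 2, 1 / 2, by norm_num, by norm_num, by norm_num, by rw [hs']; module⟩
  have := hQ.mem_inside_iff.1 (hsub hmem) j
  rw [hs'] at hj
  rw [height_add_smul] at this hj
  have h2 : t * cross (edge Q j) v < 0 := by linarith
  exact (pos_iff_neg_of_mul_neg h2).1 ht

lemma lineThrough_add_smul (s v : Plane) (t : ℝ) :
    lineThrough (s + t • v) v = lineThrough s v := by
  simp [lineThrough, cross_add_left, cross_smul_left]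

lemma Reaches.lineThrough_eq {s s' v : Plane} (h : Reaches Q (s, v) s') :
    lineThrough s' v = lineThrough s v := by
  obtain ⟨-, ⟨t, ht, hs'⟩, -⟩ := h
  rw [hs', lineThrough_add_smul]

lemma IsConvexPolygon.reaches_unique (hQ : IsConvexPolygon Q) {x : Plane × Plane} {s s' : Plane}
    (h : Reaches Q x s) (h' : Reaches Q x s') : s = s' := by
  obtain ⟨t, ht, hs⟩ := h.2.1
  obtain ⟨t', ht', hs'⟩ := h'.2.1
  wlog hlt : t < t' generalizing s s' t t'
  · rcases (not_lt.1 hlt).eq_or_lt with heq | hlt'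
    · rw [hs, hs', heq]
    · exact (this h' h t' ht' hs' t ht hs hlt').symm
  refine absurd (h'.2.2 ⟨1 - t / t', t / t', ?_, by positivity, by ring, ?_⟩)
    (hQ.notMem_inside_of_mem_boundary h.1)
  · rw [sub_pos, div_lt_one ht']; exact hlt
  · rw [hs, hs', smul_add, smul_smul, div_mul_cancel₀ _ ht'.ne', ← add_assoc, ← add_smul]
    simp

lemma IsConvexPolygon.exits_of_reaches (hQ : IsConvexPolygon Q) {s s' v : Plane} {j : Fin r}
    (h : Reaches Q (s, v) s') (hs' : s' ∈ openSide Q j) : Exits Q j (lineThrough s v) := by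
  rw [← h.lineThrough_eq, exits_lineThrough_iff hs']
  exact hQ.cross_neg_of_reaches h (height_openSide hs')

lemma IsConvexPolygon.exists_reaches_of_exits (hQ : IsConvexPolygon Q) {s v : Plane} {j : Fin r}
    (hs : s ∈ Q.boundary ℝ) (hv : Inward Q s v) (h : Exits Q j (lineThrough s v)) :
    ∃ s' ∈ openSide Q j, Reaches Q (s, v) s' := by
  obtain ⟨s', hs', hline, hneg⟩ := exists_exit_point h
  exact ⟨s', hs', hQ.reaches_of_cross_neg hs hv (openSide_subset_boundary hs')
    (by rwa [side_lineThrough] at hline) (height_openSide hs') hneg⟩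

lemma height_symm_vertex (b : Fin r) : height Q ((finRotate r).symm b) (Q b) = 0 := by
  nth_rw 2 [← (finRotate r).apply_symm_apply b]
  exact height_end _

lemma IsConvexPolygon.exitsAt_of_reaches (hQ : IsConvexPolygon Q) {s v : Plane} {b : Fin r}
    (h : Reaches Q (s, v) (Q b)) : ExitsAt Q b (lineThrough s v) := by
  have h1 := hQ.cross_neg_of_reaches h (height_start b)
  have h2 := hQ.cross_neg_of_reaches h (height_symm_vertex b)
  rw [← h.lineThrough_eq]
  rw [edge, Equiv.apply_symm_apply, cross_sub_left] at h2
  refine ⟨?_, ?_, ?_⟩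
  · rw [side_lineThrough, cross_sub_left]; linarith
  · rw [side_lineThrough]; simp
  · rw [side_lineThrough]; exact h1

lemma IsConvexPolygon.reaches_of_exitsAt (hQ : IsConvexPolygon Q) {s v : Plane} {b : Fin r}
    (hs : s ∈ Q.boundary ℝ) (hv : Inward Q s v) (h : ExitsAt Q b (lineThrough s v)) :
    Reaches Q (s, v) (Q b) := by
  obtain ⟨-, h1, h2⟩ := h
  rw [side_lineThrough] at h1 h2
  refine hQ.reaches_of_cross_neg hs hv (vertex_mem_boundary b) h1 (height_start b) ?_
  rw [cross_sub_left] at h1 h2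
  rw [edge, cross_sub_left]; linarith

lemma IsConvexPolygon.follows_step (hQ : IsConvexPolygon Q) {x y : Plane × Plane} {j : Fin r}
    (h : BilliardMap Q x y) (hj : y.1 ∈ openSide Q j) :
    Exits Q j (lineOf x) ∧ lineOf y = reflectLine Q j (lineOf x) := by
  obtain ⟨hr, i, hi, hy⟩ := h
  obtain rfl := hQ.openSide_disjoint hi hj
  refine ⟨hQ.exits_of_reaches hr hj, ?_⟩
  have := hr.lineThrough_eq
  rw [lineOf, lineOf, ← this, hQ.reflectLine_lineThrough (height_openSide hj), hy]

lemma IsConvexPolygon.exists_billiardMap (hQ : IsConvexPolygon Q) {x : Plane × Plane}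
    (hx : x ∈ phaseSpace Q) {j : Fin r} (h : Exits Q j (lineOf x)) :
    ∃ y ∈ phaseSpace Q, BilliardMap Q x y ∧ y.1 ∈ openSide Q j := by
  obtain ⟨s', hs', hr⟩ := hQ.exists_reaches_of_exits hx.1 hx.2.2 h
  refine ⟨(s', mirror Q j x.2), ⟨openSide_subset_boundary hs', ?_, ?_⟩, ⟨hr, j, hs', rfl⟩, hs'⟩
  · rw [norm_mirror]; exact hx.2.1
  · refine (hQ.inward_iff_of_mem_openSide hs').2 ?_
    rw [cross_edge_mirror]
    exact neg_pos.2 (hQ.cross_neg_of_reaches hr (height_openSide hs'))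

lemma IsConvexPolygon.billiardMap_unique (hQ : IsConvexPolygon Q) {x y y' : Plane × Plane}
    (h : BilliardMap Q x y) (h' : BilliardMap Q x y') : y = y' := by
  obtain ⟨hr, i, hi, hy⟩ := h
  obtain ⟨hr', i', hi', hy'⟩ := h'
  have h1 := hQ.reaches_unique hr hr'
  rw [← h1] at hi'
  obtain rfl := hQ.openSide_disjoint hi hi'
  exact Prod.ext h1 (hy.trans hy'.symm)

lemma IsConvexPolygon.follows_of_orbit (hQ : IsConvexPolygon Q) {n : ℕ} (w : Fin n → Fin r)
    (X : ℕ → Plane × Plane)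
    (hX : ∀ k : Fin n, BilliardMap Q (X k) (X (k + 1)) ∧ (X (k + 1)).1 ∈ openSide Q (w k)) :
    Follows Q (List.ofFn w) (lineOf (X 0)) ∧
      transport Q (List.ofFn w) (lineOf (X 0)) = lineOf (X n) := by
  induction n generalizing X with
  | zero => simp [Follows]
  | succ n ih =>
    have h0 := hX 0
    have h1 := hQ.follows_step h0.1 h0.2
    have := ih (fun k => w k.succ) (fun k => X (k + 1)) fun k => by simpa using hX k.succ
    simp only [Fin.val_zero, zero_add] at h1 this
    rw [h1.2] at this
    rw [List.ofFn_succ, transport_cons]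
    exact ⟨⟨h1.1, this.1⟩, this.2⟩

lemma IsConvexPolygon.exists_orbit (hQ : IsConvexPolygon Q) {n : ℕ} (w : Fin n → Fin r)
    {x : Plane × Plane} (hx : x ∈ phaseSpace Q) (h : Follows Q (List.ofFn w) (lineOf x)) :
    ∃ X : ℕ → Plane × Plane, X 0 = x ∧ (∀ k ≤ n, X k ∈ phaseSpace Q) ∧
      ∀ k : Fin n, BilliardMap Q (X k) (X (k + 1)) ∧ (X (k + 1)).1 ∈ openSide Q (w k) := by
  induction n generalizing x with
  | zero => exact ⟨fun _ => x, rfl, fun _ _ => hx, fun k => k.elim0⟩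
  | succ n ih =>
    rw [List.ofFn_succ] at h
    obtain ⟨y, hy, hxy, hyw⟩ := hQ.exists_billiardMap hx h.1
    obtain ⟨Y, hY0, hYp, hY⟩ := ih (fun k => w k.succ) hy (by
      rw [(hQ.follows_step hxy hyw).2]; exact h.2)
    refine ⟨fun k => Nat.casesOn k x Y, rfl, ?_, ?_⟩
    · rintro (_ | k) hk
      · exact hx
      · exact hYp k (by omega)
    · intro k
      refine Fin.cases ?_ (fun k => ?_) k
      · simp only [Fin.val_zero]; rw [hY0]; exact ⟨hxy, hyw⟩
      · exact hY k

/-- In the unfolding of the table along its itinerary, an orbit that ends in a vertex is a straight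
segment, of positive length. -/
lemma IsConvexPolygon.unfold_vertex_eq (hQ : IsConvexPolygon Q) {w : List (Fin r)} {b : Fin r}
    {x : Plane × Plane} (hx : x ∈ phaseSpace Q) (h : Follows Q w (lineOf x))
    (hb : ExitsAt Q b (transport Q w (lineOf x))) :
    ∃ T : ℝ, 0 < T ∧ unfold Q w (Q b) = x.1 + T • x.2 := by
  induction w generalizing x with
  | nil => exact (hQ.reaches_of_exitsAt hx.1 hx.2.2 hb).2.1
  | cons i w ih =>
    obtain ⟨y, hy, hxy, hyi⟩ := hQ.exists_billiardMap hx h.1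
    have hline := (hQ.follows_step hxy hyi).2
    obtain ⟨T, hT, hTeq⟩ := ih hy (by rw [hline]; exact h.2) (by rw [hline]; exact hb)
    obtain ⟨⟨-, ⟨t, ht, hty⟩, -⟩, j, hj, hyv⟩ := hxy
    obtain rfl := hQ.openSide_disjoint hj hyi
    refine ⟨t + T, by positivity, ?_⟩
    rw [unfold, hTeq, reflectPoint_add_smul, hQ.reflectPoint_eq_self (height_openSide hj), hyv,
      mirror_mirror, hty]
    module

/-! ### Extending words and fans by one letter -/

/-- The line through the vertex `a`, as a linear function of its direction. -/
def rayFrom (Q : Polygon Plane r) (a : Fin r) : Plane →ₗ[ℝ] OrientedLine where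
  toFun v := lineThrough (Q a) v
  map_add' u v := by simp [lineThrough, cross_add_right]
  map_smul' t v := by simp [lineThrough, cross_smul_right]

lemma rayFrom_apply (a : Fin r) (v : Plane) : rayFrom Q a v = lineThrough (Q a) v := rfl

/-- The fan of the vertex `a` along the word `w`: the directions, of arbitrary length, in which the
ball that starts in the vertex `a` runs into the table and then hits the sides `w` one after the
other. -/
def fan (Q : Polygon Plane r) (a : Fin r) (w : List (Fin r)) : Set Plane :=
  {v | ExitsAt Q a (-rayFrom Q a v) ∧ Follows Q w (rayFrom Q a v)}

/-- In some direction of the fan of `a` along `w` the ball finally runs into the vertex `b`: there is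
a generalized diagonal from `a` to `b` that hits the sides `w` in between. -/
def IsDiagonalCode (Q : Polygon Plane r) (a : Fin r) (w : List (Fin r)) (b : Fin r) : Prop :=
  ∃ v ∈ fan Q a w, ExitsAt Q b (transport Q w (rayFrom Q a v))

lemma fan_eq (a : Fin r) (w : List (Fin r)) : fan Q a w =
    {v | side (Q ((finRotate r).symm a)) (rayFrom Q a v) < 0} ∩
      {v | 0 < side (Q (finRotate r a)) (rayFrom Q a v)} ∩ rayFrom Q a ⁻¹' {x | Follows Q w x} := by
  ext v
  have : side (Q a) (rayFrom Q a v) = 0 := by rw [rayFrom_apply, side_lineThrough]; simp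
  simp [fan, ExitsAt, this]

lemma convex_fan (a : Fin r) (w : List (Fin r)) : Convex ℝ (fan Q a w) := by
  rw [fan_eq]
  exact ((convex_halfSpace_lt ((side _).comp (rayFrom Q a)).isLinear 0).inter
    (convex_halfSpace_gt ((side _).comp (rayFrom Q a)).isLinear 0)).inter
    ((convex_setOf_follows w).linear_preimage (rayFrom Q a))

lemma isOpen_fan (a : Fin r) (w : List (Fin r)) : IsOpen (fan Q a w) := by
  rw [fan_eq]
  exact ((isOpen_lt ((side _).comp (rayFrom Q a)).continuous_of_finiteDimensional
    continuous_const).inter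
    (isOpen_lt continuous_const ((side _).comp (rayFrom Q a)).continuous_of_finiteDimensional)).inter
    ((isOpen_setOf_follows w).preimage (rayFrom Q a).continuous_of_finiteDimensional)

lemma ne_zero_of_mem_fan {a : Fin r} {w : List (Fin r)} {v : Plane} (hv : v ∈ fan Q a w) :
    v ≠ 0 := by
  rintro rfl
  have := hv.1.1
  simp at this

lemma IsConvexPolygon.mem_phaseSpace_vertex (hQ : IsConvexPolygon Q) {a : Fin r} {v : Plane}
    (hv : ‖v‖ = 1) (h : ExitsAt Q a (-rayFrom Q a v)) : (Q a, v) ∈ phaseSpace Q :=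
  ⟨vertex_mem_boundary a, hv, hQ.inward_vertex_iff.2 h⟩

lemma IsDiagonalCode.exists_unit {a b : Fin r} {w : List (Fin r)} (h : IsDiagonalCode Q a w b) :
    ∃ v ∈ fan Q a w, ‖v‖ = 1 ∧ ExitsAt Q b (transport Q w (rayFrom Q a v)) := by
  obtain ⟨v, hv, hb⟩ := h
  have hpos : 0 < ‖v‖⁻¹ := inv_pos.2 (norm_pos_iff.2 (ne_zero_of_mem_fan hv))
  refine ⟨‖v‖⁻¹ • v, ⟨?_, ?_⟩, ?_, ?_⟩
  · rw [map_smul, ← smul_neg]; exact hv.1.smul hpos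
  · rw [map_smul]; exact hv.2.smul hpos
  · rw [norm_smul, norm_inv, norm_norm, inv_mul_cancel₀ (inv_pos.1 hpos).ne']
  · rw [map_smul, map_smul]; exact hb.smul hpos

open Classical in
/-- The vertices in which generalized diagonals end cut the fan of `a` along `w` into the fans of
the words that extend `w` by a last letter. Being in line with such a vertex is a nontrivial condition
on the lines through `a`, because the unfolded end point of a generalized diagonal that starts in `a`
differs from `a`. -/
lemma IsConvexPolygon.card_fan_extensions (hQ : IsConvexPolygon Q) {a : Fin r} {w : List (Fin r)}
    (hne : (fan Q a w).Nonempty) :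
    (Finset.univ.filter fun j => (fan Q a (w ++ [j])).Nonempty).card =
      (Finset.univ.filter fun b => IsDiagonalCode Q a w b).card + 1 := by
  have hr := hQ.1
  have hgen : ∀ b, ∀ v ∈ fan Q a w, ExitsAt Q b ((transport Q w ∘ₗ rayFrom Q a) v) →
      ∃ u, side (Q b) ((transport Q w ∘ₗ rayFrom Q a) u) ≠ 0 := by
    intro b v hv hb
    obtain ⟨v', hv', hnorm, hb'⟩ := IsDiagonalCode.exists_unit (b := b) ⟨v, hv, hb⟩
    obtain ⟨T, hT, hTeq⟩ :=
      hQ.unfold_vertex_eq (hQ.mem_phaseSpace_vertex hnorm hv'.1) hv'.2 hb'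
    by_contra! hcon
    have hzero : unfold Q w (Q b) - Q a = 0 := by
      refine eq_zero_of_forall_cross_eq_zero fun u => ?_
      have := hcon u
      rw [LinearMap.comp_apply, hQ.side_transport] at this
      simpa [rayFrom_apply, side_lineThrough] using this
    rw [hTeq, add_sub_cancel_left, smul_eq_zero] at hzero
    rcases hzero with h | h
    · exact hT.ne' h
    · exact ne_zero_of_mem_fan hv' h
  have hext : ∀ j, (fan Q a (w ++ [j])).Nonempty ↔
      ∃ v ∈ fan Q a w, Exits Q j ((transport Q w ∘ₗ rayFrom Q a) v) := by
    intro j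
    simp only [fan, follows_append_singleton, Set.Nonempty, mem_ofPred_eq, LinearMap.comp_apply,
      and_assoc]
  simp only [hext]
  rcases List.eq_nil_or_concat w with rfl | ⟨w', i, hw⟩
  · have hsymm : (finRotate r)^[r - 2] (finRotate r a) = (finRotate r).symm a := by
      rw [Equiv.eq_symm_apply, ← Function.iterate_succ_apply,
        ← Function.iterate_succ_apply' (finRotate r), show (r - 2).succ.succ = r by omega,
        finRotate_iterate_self]
    refine hQ.card_exits (convex_fan a _) (isOpen_fan a _) hne _ (finRotate r a) (N := r - 2)
      (by omega) ?_ ?_ ?_ hgen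
    · intro v hv
      have := hv.1.2.2
      rw [map_neg] at this
      exact neg_neg_iff_pos.1 this
    · intro v hv
      rw [hsymm]
      have := hv.1.1
      rw [map_neg] at this
      exact neg_pos.1 this
    · intro v hv k hk hkr
      rw [show k = r - 1 by omega, ← Function.iterate_succ_apply,
        show (r - 1).succ = r by omega, finRotate_iterate_self]
      have := hv.1.2.1
      rw [map_neg, neg_eq_zero] at this
      exact this.le
  · rw [List.concat_eq_append] at hw
    have hin : ∀ v ∈ fan Q a w, Exits Q i (-transport Q w (rayFrom Q a v)) := by
      intro v hv
      have h := hv.2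
      rw [hw] at h ⊢
      exact hQ.exits_neg_transport h
    refine hQ.card_exits (convex_fan a _) (isOpen_fan a _) hne _ (finRotate r i) (N := r - 1)
      (by omega) ?_ ?_ (fun _ _ k _ _ => by omega) hgen
    · intro v hv
      have := (hin v hv).2
      rw [map_neg] at this
      exact neg_neg_iff_pos.1 this
    · intro v hv
      rw [← Function.iterate_succ_apply, show (r - 1).succ = r by omega, finRotate_iterate_self]
      have := (hin v hv).1
      rw [map_neg] at this
      exact neg_pos.1 this

/-- Some oriented line follows the list of sides. -/
def IsItinerary (Q : Polygon Plane r) (w : List (Fin r)) : Prop := ∃ x, Follows Q w x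

lemma IsItinerary.of_cons {i : Fin r} {w : List (Fin r)} (h : IsItinerary Q (i :: w)) :
    IsItinerary Q w := by
  obtain ⟨x, hx⟩ := h
  exact ⟨_, hx.2⟩

lemma IsItinerary.of_fan {a : Fin r} {w : List (Fin r)} (h : (fan Q a w).Nonempty) :
    IsItinerary Q w := by
  obtain ⟨v, hv⟩ := h
  exact ⟨_, hv.2⟩

lemma IsConvexPolygon.exits_neg_reflectLine_iff (hQ : IsConvexPolygon Q) (a : Fin r)
    (x : OrientedLine) : Exits Q a (-reflectLine Q a x) ↔ Exits Q a x := by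
  rw [Exits, Exits, map_neg, map_neg, hQ.side_reflectLine_start, hQ.side_reflectLine_end, neg_neg,
    neg_neg]

open Classical in
/-- Followed backwards, the lines of a word leave the table through the sides whose letters can
precede the word, and through the vertices from which the word is seen. -/
lemma IsConvexPolygon.card_left_extensions (hQ : IsConvexPolygon Q) {i : Fin r} {w : List (Fin r)}
    (hw : IsItinerary Q (i :: w)) :
    (Finset.univ.filter fun a => IsItinerary Q (a :: i :: w)).card =
      (Finset.univ.filter fun b => (fan Q b (i :: w)).Nonempty).card + 1 := by
  have hr := hQ.1
  have h1 : ∀ a, IsItinerary Q (a :: i :: w) ↔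
      ∃ x ∈ {x | Follows Q (i :: w) x}, Exits Q a ((-LinearMap.id : _ →ₗ[ℝ] OrientedLine) x) := by
    intro a
    constructor
    · rintro ⟨x, hx, hx'⟩
      exact ⟨_, hx', (hQ.exits_neg_reflectLine_iff a x).2 hx⟩
    · rintro ⟨x, hx, hx'⟩
      refine ⟨reflectLine Q a x, ?_, ?_⟩
      · rw [← hQ.exits_neg_reflectLine_iff, reflectLine_reflectLine]; exact hx'
      · rw [reflectLine_reflectLine]; exact hx
  have h2 : ∀ b, (fan Q b (i :: w)).Nonempty ↔
      ∃ x ∈ {x | Follows Q (i :: w) x}, ExitsAt Q b ((-LinearMap.id : _ →ₗ[ℝ] OrientedLine) x) := by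
    intro b
    constructor
    · rintro ⟨v, hv, hv'⟩
      exact ⟨_, hv', hv⟩
    · rintro ⟨x, hx, hx'⟩
      have hmem : rayFrom Q b x.1 = x := by
        have : side (Q b) (-x) = 0 := hx'.2.1
        rw [map_neg, neg_eq_zero, side_apply, sub_eq_zero] at this
        exact Prod.ext rfl this
      refine ⟨x.1, ?_, ?_⟩
      · rw [hmem]; exact hx'
      · rw [hmem]; exact hx
  simp only [h1, h2]
  refine hQ.card_exits (convex_setOf_follows _) (isOpen_setOf_follows _)
    (show {x | Follows Q (i :: w) x}.Nonempty from hw) _ (finRotate r i)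
    (N := r - 1) (by omega) ?_ ?_ (fun _ _ k _ _ => by omega) ?_
  · intro x hx
    have : side (Q (finRotate r i)) x < 0 := hx.1.2
    simpa using this
  · intro x hx
    rw [← Function.iterate_succ_apply, show (r - 1).succ = r by omega, finRotate_iterate_self]
    have : 0 < side (Q i) x := hx.1.1
    simpa using this
  · intro b x hx hb
    exact ⟨(0, 1), by simp [side_apply]⟩

/-! ### Counting words, fans and generalized diagonals -/

open Classical in
/-- The number of words of length `n` that some oriented line follows. -/
def wordCount (Q : Polygon Plane r) (n : ℕ) : ℕ :=
  (Finset.univ.filter fun w : Fin n → Fin r => IsItinerary Q (List.ofFn w)).card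

open Classical in
/-- The number of pairs of a vertex and a word of length `n` that is seen from this vertex. -/
def fanCount (Q : Polygon Plane r) (n : ℕ) : ℕ :=
  ∑ a : Fin r, (Finset.univ.filter fun w : Fin n → Fin r => (fan Q a (List.ofFn w)).Nonempty).card

open Classical in
/-- The triples of first vertex, word of length `n` and last vertex of the generalized diagonals with
`n` reflections. -/
def diagonalCodes (Q : Polygon Plane r) (n : ℕ) : Finset (Fin r × (Fin n → Fin r) × Fin r) :=
  Finset.univ.filter fun c => IsDiagonalCode Q c.1 (List.ofFn c.2.1) c.2.2

open Classical in
lemma card_filter_ofFn_cons {n : ℕ} (P : List (Fin r) → Prop) :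
    (Finset.univ.filter fun u : Fin (n + 1) → Fin r => P (List.ofFn u)).card =
      ∑ w : Fin n → Fin r, (Finset.univ.filter fun a => P (a :: List.ofFn w)).card := by
  simp only [Finset.card_filter]
  rw [Finset.sum_comm, ← Fintype.sum_prod_type',
    ← Equiv.sum_comp (Fin.consEquiv fun _ : Fin (n + 1) => Fin r)]
  simp [Fin.consEquiv]

open Classical in
lemma card_filter_ofFn_snoc {n : ℕ} (P : List (Fin r) → Prop) :
    (Finset.univ.filter fun u : Fin (n + 1) → Fin r => P (List.ofFn u)).card =
      ∑ w : Fin n → Fin r, (Finset.univ.filter fun a => P (List.ofFn w ++ [a])).card := by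
  simp only [Finset.card_filter]
  rw [Finset.sum_comm, ← Fintype.sum_prod_type',
    ← Equiv.sum_comp (Fin.snocEquiv fun _ : Fin (n + 1) => Fin r)]
  simp [Fin.snocEquiv, List.ofFn_succ', -List.ofFn_succ]

lemma IsConvexPolygon.wordCount_succ (hQ : IsConvexPolygon Q) (n : ℕ) :
    wordCount Q (n + 2) = wordCount Q (n + 1) + fanCount Q (n + 1) := by
  classical
  have key : ∀ w : Fin (n + 1) → Fin r,
      (Finset.univ.filter fun a => IsItinerary Q (a :: List.ofFn w)).card =
        (if IsItinerary Q (List.ofFn w) then 1 else 0) +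
          (Finset.univ.filter fun b => (fan Q b (List.ofFn w)).Nonempty).card := by
    intro w
    split_ifs with h
    · rw [List.ofFn_succ] at h ⊢
      rw [hQ.card_left_extensions h, add_comm]
    · rw [Finset.filter_false_of_mem fun a _ ha => h (IsItinerary.of_cons ha),
        Finset.filter_false_of_mem fun b _ hb => h (IsItinerary.of_fan hb)]
      rfl
  rw [wordCount, card_filter_ofFn_cons]
  simp only [key]
  rw [Finset.sum_add_distrib, wordCount, fanCount]
  simp only [Finset.card_filter]
  rw [Finset.sum_comm (γ := Fin (n + 1) → Fin r)]

lemma IsConvexPolygon.fanCount_succ (hQ : IsConvexPolygon Q) (n : ℕ) :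
    fanCount Q (n + 1) = fanCount Q n + (diagonalCodes Q n).card := by
  classical
  have key : ∀ (a : Fin r) (w : Fin n → Fin r),
      (Finset.univ.filter fun j => (fan Q a (List.ofFn w ++ [j])).Nonempty).card =
        (if (fan Q a (List.ofFn w)).Nonempty then 1 else 0) +
          (Finset.univ.filter fun b => IsDiagonalCode Q a (List.ofFn w) b).card := by
    intro a w
    split_ifs with h
    · rw [hQ.card_fan_extensions h, add_comm]
    · rw [Finset.filter_false_of_mem fun j _ hj => h ?_,
        Finset.filter_false_of_mem fun b _ hb => h ?_]
      · rfl
      · obtain ⟨v, hv, -⟩ := hb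
        exact ⟨v, hv⟩
      · obtain ⟨v, hv, hv'⟩ := hj
        exact ⟨v, hv, ((follows_append_singleton _ _ _).1 hv').1⟩
  simp only [fanCount, diagonalCodes]
  have h : ∀ a : Fin r, (Finset.univ.filter
      fun w : Fin (n + 1) → Fin r => (fan Q a (List.ofFn w)).Nonempty).card = _ :=
    fun a => card_filter_ofFn_snoc fun w => (fan Q a w).Nonempty
  simp only [h, key, Finset.sum_add_distrib, Finset.card_filter, Fintype.sum_prod_type]

lemma IsConvexPolygon.fan_nil_nonempty (hQ : IsConvexPolygon Q) (a : Fin r) :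
    (fan Q a []).Nonempty := by
  have h : 0 < cross (edge Q ((finRotate r).symm a)) (edge Q a) := by
    have := hQ.height_pos (i := (finRotate r).symm a) (k := finRotate r a)
      (by intro h; exact hQ.finRotate_finRotate_ne a (by rw [h, Equiv.apply_symm_apply]))
      (by rw [Equiv.apply_symm_apply]; exact hQ.finRotate_ne a)
    rw [height] at this
    have e : edge Q a = (Q (finRotate r a) - Q ((finRotate r).symm a)) -
        edge Q ((finRotate r).symm a) := by
      rw [edge, edge, Equiv.apply_symm_apply]; abel
    rw [e, cross_sub_right, cross_self, sub_zero]
    exact this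
  refine ⟨edge Q a - edge Q ((finRotate r).symm a), ?_, trivial⟩
  rw [rayFrom_apply, ← hQ.inward_vertex_iff, hQ.inward_iff fun i => hQ.height_nonneg i a]
  intro i hi
  by_cases hia : a = i
  · rw [← hia, cross_sub_right, cross_self, cross_swap (edge Q a)]; linarith
  by_cases hib : a = finRotate r i
  · have : i = (finRotate r).symm a := by rw [hib, Equiv.symm_apply_apply]
    rw [this, cross_sub_right, cross_self, sub_zero]; exact h
  · exact absurd hi (hQ.height_pos hia hib).ne'

lemma IsConvexPolygon.fanCount_zero (hQ : IsConvexPolygon Q) : fanCount Q 0 = r := by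
  classical
  simp [fanCount, hQ.fan_nil_nonempty]

lemma IsConvexPolygon.isItinerary_singleton (hQ : IsConvexPolygon Q) (i : Fin r) :
    IsItinerary Q [i] := by
  -- the lines from the next vertex but one through the midpoint of the side
  set m : Plane := (1 / 2 : ℝ) • Q i + (1 / 2 : ℝ) • Q (finRotate r i) with hm
  set c := Q (finRotate r (finRotate r i)) with hc
  have h : 0 < height Q i c := hQ.height_pos (hQ.finRotate_finRotate_ne i) (hQ.finRotate_ne _)
  have e : cross (edge Q i) (m - c) = -height Q i c := by
    simp only [height, edge, hm, cross]; simp; ring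
  have e1 : Q i - m = (-1 / 2 : ℝ) • edge Q i := by rw [hm, edge]; module
  have e2 : Q (finRotate r i) - m = (1 / 2 : ℝ) • edge Q i := by rw [hm, edge]; module
  refine ⟨lineThrough m (m - c), ⟨?_, ?_⟩, trivial⟩
  · rw [side_lineThrough, e1, cross_smul_left, e]; linarith
  · rw [side_lineThrough, e2, cross_smul_left, e]; linarith

lemma IsConvexPolygon.wordCount_one (hQ : IsConvexPolygon Q) : wordCount Q 1 = r := by
  classical
  simp [wordCount, hQ.isItinerary_singleton]

/-! ### Words and generalized diagonals of the billiard -/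

lemma IsConvexPolygon.mem_language_iff (hQ : IsConvexPolygon Q) {n : ℕ} {w : Fin (n + 1) → Fin r} :
    w ∈ language Q (n + 1) ↔ IsItinerary Q (List.ofFn w) := by
  rw [List.ofFn_succ]
  constructor
  · rintro ⟨x, hx, hmap⟩
    have h0 := hx 0
    set X : ℕ → Plane × Plane := fun k => if h : k < n + 1 then x ⟨k, h⟩ else x 0 with hX
    have hXk : ∀ k (h : k < n + 1), X k = x ⟨k, h⟩ := fun k h => dif_pos h
    have hfol := hQ.follows_of_orbit (fun k => w k.succ) X (fun k => by
      rw [hXk k (by omega), hXk (k + 1) (by omega)]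
      exact ⟨hmap _ _ rfl, (hx k.succ).2⟩)
    rw [hXk 0 (by omega)] at hfol
    refine ⟨reflectLine Q (w 0) (lineOf (x 0)), ?_, ?_⟩
    · have hneg : -lineOf (x 0) = lineThrough (x 0).1 (-(x 0).2) := by
        simp [lineOf, lineThrough, cross]; ring
      have hin := (hQ.inward_iff_of_mem_openSide h0.2).1 h0.1.2.2
      rw [← hQ.exits_neg_reflectLine_iff, reflectLine_reflectLine, hneg,
        exits_lineThrough_iff h0.2, ← neg_one_smul ℝ, cross_smul_right]
      linarith
    · rw [reflectLine_reflectLine]; exact hfol.1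
  · rintro ⟨x, hx, hx'⟩
    obtain ⟨s, hs, hline, hneg⟩ := exists_exit_point hx
    have hv : x.1 ≠ 0 := by intro h; rw [h] at hneg; simp at hneg
    have hpos : 0 < ‖x.1‖⁻¹ := inv_pos.2 (norm_pos_iff.2 hv)
    have hxs : lineThrough s x.1 = x := Prod.ext rfl (sub_eq_zero.1 hline)
    -- the phase point in which the reflected line starts, with the velocity normalized
    set v := ‖x.1‖⁻¹ • mirror Q (w 0) x.1 with hvdef
    have hlv : lineThrough s v = ‖x.1‖⁻¹ • reflectLine Q (w 0) x := by
      nth_rw 2 [← hxs]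
      rw [hQ.reflectLine_lineThrough (height_openSide hs)]
      simp [lineThrough, hvdef, cross_smul_right]
    have hphase : (s, v) ∈ phaseSpace Q := by
      refine ⟨openSide_subset_boundary hs, ?_, (hQ.inward_iff_of_mem_openSide hs).2 ?_⟩
      · rw [hvdef, norm_smul, norm_mirror, norm_inv, norm_norm,
          inv_mul_cancel₀ (inv_pos.1 hpos).ne']
      · rw [hvdef, cross_smul_right, cross_edge_mirror]
        exact mul_pos hpos (neg_pos.2 hneg)
    obtain ⟨X, hX0, hXp, hX⟩ := hQ.exists_orbit (fun k => w k.succ) hphase (by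
      rw [lineOf, hlv]; exact hx'.smul hpos)
    refine ⟨fun k => X k, fun k => ⟨hXp k (by omega), ?_⟩, ?_⟩
    · refine Fin.cases ?_ (fun k => ?_) k
      · simp only [Fin.val_zero]; rw [hX0]; exact hs
      · exact (hX k).2
    · intro k l hkl
      simp only [hkl]
      exact (hX ⟨k, by omega⟩).1

/-- The generalized diagonal with the boundary points `q` leads from the vertex `a` to the vertex
`b`, and hits the sides `w` in between. -/
def IsDiagonalWith (Q : Polygon Plane r) {n : ℕ} (a : Fin r) (w : Fin n → Fin r) (b : Fin r)
    (q : Fin (n + 2) → Plane) : Prop :=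
  q 0 = Q a ∧ q (Fin.last (n + 1)) = Q b ∧ ∃ X : ℕ → Plane × Plane,
    (∀ k : Fin (n + 1), q k.castSucc = (X k).1) ∧ (∀ k ≤ n, X k ∈ phaseSpace Q) ∧
    (∀ k : Fin n, BilliardMap Q (X k) (X (k + 1)) ∧ (X (k + 1)).1 ∈ openSide Q (w k)) ∧
    Reaches Q (X n) (Q b)

lemma isGeneralizedDiagonal_succ_iff {n : ℕ} {q : Fin (n + 2) → Plane} :
    IsGeneralizedDiagonal Q (n + 1) q ↔ ∃ a w b, IsDiagonalWith Q a w b q := by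
  constructor
  · rintro ⟨⟨a, ha⟩, ⟨b, hb⟩, v, hv, hmap⟩
    set X : ℕ → Plane × Plane := fun k =>
      if h : k < n + 1 then (q (Fin.castSucc ⟨k, h⟩), v ⟨k, h⟩) else (0, 0) with hX
    have hXk : ∀ k (h : k < n + 1), X k = (q (Fin.castSucc ⟨k, h⟩), v ⟨k, h⟩) :=
      fun k h => dif_pos h
    have hB : ∀ k : Fin n, BilliardMap Q (X k) (X (k + 1)) := by
      intro k
      rw [hXk k (by omega), hXk (k + 1) (by omega)]
      exact hmap _ _ rfl
    choose w hw using fun k => (hB k).2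
    refine ⟨a, w, b, ha.symm, hb.symm, X, ?_, ?_, fun k => ⟨hB k, (hw k).1⟩, ?_⟩
    · intro k; rw [hXk k k.2]
    · intro k hk; rw [hXk k (by omega)]; exact (hv _).1
    · rw [hXk n (by omega)]
      have := (hv (Fin.last n)).2
      rw [Fin.succ_last, ← hb] at this
      exact this
  · rintro ⟨a, w, b, ha, hb, X, hq, hp, hB, hlast⟩
    have hpair : ∀ k : Fin (n + 1), (q k.castSucc, (X k).2) = X k := fun k =>
      Prod.ext (hq k) rfl
    refine ⟨⟨a, ha.symm⟩, ⟨b, hb.symm⟩, fun k => (X k).2, ?_, ?_⟩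
    · intro k
      simp only [hpair]
      refine ⟨hp k (by omega), ?_⟩
      refine Fin.lastCases ?_ (fun k => ?_) k
      · rw [Fin.succ_last, hb]; exact hlast
      · rw [Fin.succ_castSucc, hq]; exact (hB k).1.1
    · intro k l hkl
      simp only [hpair]
      rw [hkl]
      exact (hB ⟨k, by omega⟩).1

lemma IsConvexPolygon.isDiagonalCode_of_isDiagonalWith (hQ : IsConvexPolygon Q) {n : ℕ}
    {a b : Fin r} {w : Fin n → Fin r} {q : Fin (n + 2) → Plane} (h : IsDiagonalWith Q a w b q) :
    IsDiagonalCode Q a (List.ofFn w) b := by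
  obtain ⟨ha, hb, X, hq, hp, hB, hlast⟩ := h
  have hX0 : X 0 = (Q a, (X 0).2) := Prod.ext ((hq 0).symm.trans ha) rfl
  have hfol := hQ.follows_of_orbit w X hB
  have hline : lineOf (X 0) = rayFrom Q a (X 0).2 := by rw [hX0]; rfl
  rw [hline] at hfol
  refine ⟨(X 0).2, ⟨?_, hfol.1⟩, ?_⟩
  · have := (hp 0 (by omega)).2.2
    rw [hX0] at this
    exact hQ.inward_vertex_iff.1 this
  · rw [hfol.2]; exact hQ.exitsAt_of_reaches hlast

lemma IsConvexPolygon.exists_isDiagonalWith (hQ : IsConvexPolygon Q) {n : ℕ} {a b : Fin r}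
    {w : Fin n → Fin r} (h : IsDiagonalCode Q a (List.ofFn w) b) :
    ∃ q, IsDiagonalWith Q a w b q := by
  obtain ⟨v, hv, hnorm, hb⟩ := h.exists_unit
  have hphase := hQ.mem_phaseSpace_vertex hnorm hv.1
  obtain ⟨X, hX0, hXp, hX⟩ := hQ.exists_orbit w hphase hv.2
  refine ⟨Fin.snoc (fun k : Fin (n + 1) => (X k).1) (Q b), ?_, Fin.snoc_last _ _, X, ?_, hXp, hX, ?_⟩
  · rw [← Fin.castSucc_zero, Fin.snoc_castSucc]
    simp [hX0]
  · intro k; rw [Fin.snoc_castSucc]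
  · have hfol := (hQ.follows_of_orbit w X hX).2
    rw [hX0] at hfol
    have hn := hXp n le_rfl
    exact hQ.reaches_of_exitsAt (s := (X n).1) (v := (X n).2) hn.1 hn.2.2 (by
      change ExitsAt Q b (lineOf (X n)); rw [← hfol]; exact hb)

/-- Two generalized diagonals with the same code agree: unfolded, they are the same segment. -/
lemma IsConvexPolygon.isDiagonalWith_unique (hQ : IsConvexPolygon Q) {n : ℕ} {a b : Fin r}
    {w : Fin n → Fin r} {q q' : Fin (n + 2) → Plane} (h : IsDiagonalWith Q a w b q)
    (h' : IsDiagonalWith Q a w b q') : q = q' := by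
  have hunfold : ∀ (X : ℕ → Plane × Plane), (∀ k ≤ n, X k ∈ phaseSpace Q) →
      (∀ k : Fin n, BilliardMap Q (X k) (X (k + 1)) ∧ (X (k + 1)).1 ∈ openSide Q (w k)) →
      Reaches Q (X n) (Q b) →
      ∃ T : ℝ, 0 < T ∧ unfold Q (List.ofFn w) (Q b) = (X 0).1 + T • (X 0).2 := by
    intro X hp hB hlast
    have hfol := hQ.follows_of_orbit w X hB
    exact hQ.unfold_vertex_eq (hp 0 (by omega)) hfol.1
      (by rw [hfol.2]; exact hQ.exitsAt_of_reaches hlast)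
  obtain ⟨ha, hb, X, hq, hp, hB, hlast⟩ := h
  obtain ⟨ha', hb', X', hq', hp', hB', hlast'⟩ := h'
  obtain ⟨T, hT, hTeq⟩ := hunfold X hp hB hlast
  obtain ⟨T', hT', hTeq'⟩ := hunfold X' hp' hB' hlast'
  have h1 : (X 0).1 = Q a := (hq 0).symm.trans ha
  have h1' : (X' 0).1 = Q a := (hq' 0).symm.trans ha'
  have hv : T • (X 0).2 = T' • (X' 0).2 := by
    rw [hTeq, h1, h1'] at hTeq'
    exact add_left_cancel hTeq'
  have hTT : T = T' := by
    have := congrArg norm hv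
    rwa [norm_smul, norm_smul, (hp 0 (by omega)).2.1, (hp' 0 (by omega)).2.1, mul_one, mul_one,
      Real.norm_of_nonneg hT.le, Real.norm_of_nonneg hT'.le] at this
  have h0 : X 0 = X' 0 := by
    refine Prod.ext (h1.trans h1'.symm) ?_
    rw [← hTT] at hv
    exact smul_right_injective _ hT.ne' hv
  have hXX : ∀ k ≤ n, X k = X' k := by
    intro k
    induction k with
    | zero => intro _; exact h0
    | succ k ih =>
      intro hk
      have e1 := (hB ⟨k, hk⟩).1
      have e2 := (hB' ⟨k, hk⟩).1
      rw [ih (by omega)] at e1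
      exact hQ.billiardMap_unique e1 e2
  ext1 k
  refine Fin.lastCases ?_ (fun k => ?_) k
  · rw [hb, hb']
  · rw [hq, hq', hXX k (by omega)]

lemma IsConvexPolygon.code_unique (hQ : IsConvexPolygon Q) {n : ℕ} {a b a' b' : Fin r}
    {w w' : Fin n → Fin r} {q : Fin (n + 2) → Plane} (h : IsDiagonalWith Q a w b q)
    (h' : IsDiagonalWith Q a' w' b' q) : (a, w, b) = (a', w', b') := by
  obtain ⟨ha, hb, X, hq, hp, hB, hlast⟩ := h
  obtain ⟨ha', hb', X', hq', hp', hB', hlast'⟩ := h'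
  have h1 : a = a' := hQ.injective (ha.symm.trans ha')
  have h2 : b = b' := hQ.injective (hb.symm.trans hb')
  have h3 : w = w' := by
    ext1 k
    have e1 := (hB k).2
    have e2 := (hB' k).2
    have : (X (k + 1)).1 = (X' (k + 1)).1 := (hq k.succ).symm.trans (hq' k.succ)
    rw [this] at e1
    exact hQ.openSide_disjoint e1 e2
  rw [h1, h2, h3]

lemma IsConvexPolygon.finite_and_ncard_diagonals_succ (hQ : IsConvexPolygon Q) (n : ℕ) :
    {q | IsGeneralizedDiagonal Q (n + 1) q}.Finite ∧
      {q | IsGeneralizedDiagonal Q (n + 1) q}.ncard = (diagonalCodes Q n).card := by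
  classical
  have hex : ∀ c : Fin r × (Fin n → Fin r) × Fin r, ∃ q, c ∈ diagonalCodes Q n →
      IsDiagonalWith Q c.1 c.2.1 c.2.2 q := by
    intro c
    by_cases hc : c ∈ diagonalCodes Q n
    · obtain ⟨q, hq⟩ := hQ.exists_isDiagonalWith (Finset.mem_filter.1 hc).2
      exact ⟨q, fun _ => hq⟩
    · exact ⟨0, fun h => absurd h hc⟩
  choose φ hφ using hex
  have himage : {q | IsGeneralizedDiagonal Q (n + 1) q} = φ '' diagonalCodes Q n := by
    ext q
    rw [mem_ofPred_eq, isGeneralizedDiagonal_succ_iff]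
    constructor
    · rintro ⟨a, w, b, h⟩
      have hc : (a, w, b) ∈ diagonalCodes Q n :=
        Finset.mem_filter.2 ⟨Finset.mem_univ _, hQ.isDiagonalCode_of_isDiagonalWith h⟩
      exact ⟨_, hc, hQ.isDiagonalWith_unique (hφ _ hc) h⟩
    · rintro ⟨c, hc, rfl⟩
      exact ⟨_, _, _, hφ c hc⟩
  have hinj : InjOn φ (diagonalCodes Q n) := by
    intro c hc c' hc' h
    have e := hφ c hc
    rw [h] at e
    exact hQ.code_unique e (hφ c' hc')
  rw [himage]
  exact ⟨(Finset.finite_toSet _).image _, by rw [hinj.ncard_image, ncard_coe_finset]⟩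

lemma IsConvexPolygon.finite_and_ncard_diagonals_zero (hQ : IsConvexPolygon Q) :
    {q | IsGeneralizedDiagonal Q 0 q}.Finite ∧ {q | IsGeneralizedDiagonal Q 0 q}.ncard = r := by
  have himage : {q | IsGeneralizedDiagonal Q 0 q} =
      (fun i : Fin r => fun _ : Fin 1 => Q i) '' univ := by
    ext q
    constructor
    · rintro ⟨⟨a, ha⟩, -⟩
      refine ⟨a, mem_univ _, ?_⟩
      ext1 k
      rw [Subsingleton.elim k 0]; exact ha
    · rintro ⟨a, -, rfl⟩
      exact ⟨⟨a, rfl⟩, ⟨a, rfl⟩, fun k => k.elim0, fun k => k.elim0, fun k => k.elim0⟩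
  have hinj : Function.Injective fun i : Fin r => fun _ : Fin 1 => Q i :=
    fun i j h => hQ.injective (congrFun h 0)
  rw [himage]
  exact ⟨finite_univ.image _, by rw [ncard_image_of_injective _ hinj, ncard_univ]; simp⟩

lemma generalizedDiagonals_zero :
    generalizedDiagonals Q 0 = Sigma.mk 0 '' {q | IsGeneralizedDiagonal Q 0 q} := by
  ext ⟨n, q⟩
  constructor
  · rintro ⟨hn, hq⟩
    obtain rfl : n = 0 := Nat.le_zero.1 hn
    exact ⟨q, hq, rfl⟩
  · rintro ⟨q', hq', h⟩
    rw [← h]; exact ⟨le_rfl, hq'⟩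

lemma generalizedDiagonals_succ (j : ℕ) : generalizedDiagonals Q (j + 1) =
    generalizedDiagonals Q j ∪ Sigma.mk (j + 1) '' {q | IsGeneralizedDiagonal Q (j + 1) q} := by
  ext ⟨n, q⟩
  constructor
  · rintro ⟨hn, hq⟩
    rcases Nat.le_succ_iff.1 hn with h | h
    · exact Or.inl ⟨h, hq⟩
    · obtain rfl : n = j + 1 := h
      exact Or.inr ⟨q, hq, rfl⟩
  · rintro (⟨hn, hq⟩ | ⟨q', hq', h⟩)
    · exact ⟨Nat.le_succ_of_le hn, hq⟩
    · rw [← h]; exact ⟨le_rfl, hq'⟩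

lemma IsConvexPolygon.finite_generalizedDiagonals (hQ : IsConvexPolygon Q) (j : ℕ) :
    (generalizedDiagonals Q j).Finite := by
  induction j with
  | zero => rw [generalizedDiagonals_zero]; exact hQ.finite_and_ncard_diagonals_zero.1.image _
  | succ j ih =>
    rw [generalizedDiagonals_succ]
    exact ih.union ((hQ.finite_and_ncard_diagonals_succ j).1.image _)

lemma IsConvexPolygon.diagonalCount_zero (hQ : IsConvexPolygon Q) : diagonalCount Q 0 = r := by
  rw [diagonalCount, generalizedDiagonals_zero, ncard_image_of_injective _ sigma_mk_injective]
  exact hQ.finite_and_ncard_diagonals_zero.2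

/-- Each vertex has one fan of length `0`, and every generalized diagonal of length `n + 1` cuts a fan
of length `n` and so produces one more fan of length `n + 1`. -/
lemma IsConvexPolygon.diagonalCount_eq_fanCount (hQ : IsConvexPolygon Q) (n : ℕ) :
    diagonalCount Q n = fanCount Q n := by
  induction n with
  | zero => rw [hQ.diagonalCount_zero, hQ.fanCount_zero]
  | succ n ih =>
    have hdisj : Disjoint (generalizedDiagonals Q n)
        (Sigma.mk (n + 1) '' {q | IsGeneralizedDiagonal Q (n + 1) q}) := by
      rw [disjoint_left]
      rintro _ ⟨hn, -⟩ ⟨q, -, rfl⟩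
      exact absurd hn (by simp)
    rw [diagonalCount, generalizedDiagonals_succ, ncard_union_eq hdisj
      (hQ.finite_generalizedDiagonals n) ((hQ.finite_and_ncard_diagonals_succ n).1.image _),
      ncard_image_of_injective _ sigma_mk_injective, (hQ.finite_and_ncard_diagonals_succ n).2,
      hQ.fanCount_succ, ← ih, diagonalCount]

lemma IsConvexPolygon.complexity_succ (hQ : IsConvexPolygon Q) (n : ℕ) :
    complexity Q (n + 1) = wordCount Q (n + 1) := by
  classical
  rw [complexity, if_neg (Nat.succ_ne_zero n), wordCount, ← ncard_coe_finset]
  congr 1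
  ext w
  rw [hQ.mem_language_iff]; simp

lemma IsConvexPolygon.complexity_eq_sum (hQ : IsConvexPolygon Q) (n : ℕ) :
    complexity Q n = ∑ j ∈ Finset.range n, diagonalCount Q j := by
  induction n with
  | zero => simp [complexity]
  | succ n ih =>
    rw [Finset.sum_range_succ, ← ih]
    rcases n with _ | n
    · rw [hQ.complexity_succ, hQ.wordCount_one, hQ.diagonalCount_zero]; simp [complexity]
    · rw [hQ.complexity_succ, hQ.complexity_succ, hQ.wordCount_succ, hQ.diagonalCount_eq_fanCount]

end PolygonalBilliard

end

theorem theorem1 {r : ℕ} (Q : Polygon PolygonalBilliard.Plane r)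
    (hQ : PolygonalBilliard.IsConvexPolygon Q) :
    (∀ j : ℕ, (PolygonalBilliard.generalizedDiagonals Q j).Finite) ∧
    PolygonalBilliard.diagonalCount Q 0 = r ∧
    ∀ n : ℕ, PolygonalBilliard.complexity Q n =
      ∑ j ∈ Finset.range n, PolygonalBilliard.diagonalCount Q j :=
  ⟨hQ.finite_generalizedDiagonals, hQ.diagonalCount_zero, hQ.complexity_eq_sum⟩
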